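/- Let $n\ge 0$ and let $C_2^n=\{\pm1\}^n$, on which $S_n$ acts by permuting the factors. For a binary string $l=(l_1,\dots,l_n)\in\{0,1\}^n$ let $\mathrm{sgn}_l$ be the one-dimensional real representation $(g_1,\dots,g_n)\mapsto\prod_j g_j^{l_j}$ of $C_2^n$. For $0\le i\le n$ let $\mathfrak X_i$ be the set of binary strings of length $n$ with exactly $i$ ones, let $\sigma_i=\bigoplus_{l\in\mathfrak X_i}\mathrm{sgn}_l$, and let $h_i=(-1,\dots,-1,1,\dots,1)\in C_2^n$, with $i$ entries $-1$. For a finite-dimensional real representation $\pi$ of a group $G$ let $\chi_\pi$ be its character and let $w(\pi)=\sum_{i=0}^{\dim\pi}w_i(\pi)$ be its total Stiefel–Whitney class, i.e. that of the vector bundle associated with $\pi$ over $BG$, in the mod 2 cohomology ring $H^*(G;\mathbb Z/2)$; the classes $w_i(\pi)\in H^i(G;\mathbb Z/2)$ are the unique ones with $w_0=1$, $w_i=0$ for $i>d=\dim\pi$, and $\sum_{i=0}^{d} w_i\,x^{d-i}=0$ in the cohomology of the associated bundle of projective spaces, where $x$ is the first Stiefel–Whitney class of its tautological line bundle. Let $v_j=w_1(\mathrm{sgn}_{e_j})\in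 H^1(C_2^n;\mathbb Z/2)$, where $e_j$ is the string whose only $1$ is in position $j$, and let $l\cdot v=\sum_{j=1}^n l_jv_j$. **Theorem.** Let $\pi$ be a finite-dimensional real representation of $C_2^n$ that is $S_n$-invariant, i.e. isomorphic to its twist by every permutation of the factors. Then the classes $w_i(\pi)$ exist and are unique, and $\pi\cong\bigoplus_{i=0}^n c_i\sigma_i$ for some integers $c_0,\dots,c_n\ge0$. For all such integers, $$c_i=\frac1{2^n}\sum_{k=0}^n\chi_{\sigma_k}(h_i)\,\chi_\pi(h_k)\quad(0\le i\le n),\qquad w(\pi)=\prod_{i=1}^n\Bigl(\prod_{l\in\mathfrak X_i}(1+l\cdot v)\Bigr)^{c_i}.$$ -/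

import Mathlib

open scoped DirectSum

set_option linter.unusedSectionVars false

/-! ### Mod 2 cochains on lists of vertices

A cochain is an `𝔽₂`-valued function of lists `[p₀, …, pₘ]` of vertices; its value on lists of
length `m + 1` is its component of degree `m`. -/

namespace ListCochain

variable {P Q : Type*}

/-- The simplicial coboundary `(δ f)[p₀, …, pₘ] = ∑ᵢ f [p₀, …, p̂ᵢ, …, pₘ]`. -/
def cobd (f : List P → ZMod 2) (l : List P) : ZMod 2 :=
  ∑ i ∈ Finset.range l.length, f (l.eraseIdx i)

/-- The Alexander–Whitney cup product
`(f ∪ g)[p₀, …, pₘ] = ∑ᵢ f [p₀, …, pᵢ] * g [pᵢ, …, pₘ]`. -/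
def cup (f g : List P → ZMod 2) (l : List P) : ZMod 2 :=
  ∑ i ∈ Finset.range l.length, f (l.take (i + 1)) * g (l.drop i)

/-- The unit cochain: it is `1` in degree `0`. -/
def unit (l : List P) : ZMod 2 := if l.length = 1 then 1 else 0

/-- The cup-1 product; it is used only to prove that cohomology is commutative. -/
def cupOne : (List P → ZMod 2) → (List P → ZMod 2) → List P → ZMod 2
  | _, _, [] => 0
  | f, g, p :: l => cup (fun t => g (p :: t)) (fun t => f (p :: t)) l
      + cupOne (fun t => f (p :: t)) g l

theorem two_eq (a : ZMod 2) : a + a = 0 := CharTwo.add_self_eq_zero a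

@[simp] theorem cobd_nil (f : List P → ZMod 2) : cobd f [] = 0 := by simp [cobd]

@[simp] theorem cobd_cons (f : List P → ZMod 2) (p : P) (l : List P) :
    cobd f (p :: l) = f l + cobd (fun t => f (p :: t)) l := by
  simp [cobd, Finset.sum_range_succ', add_comm]

@[simp] theorem cup_nil (f g : List P → ZMod 2) : cup f g [] = 0 := by simp [cup]

@[simp] theorem cup_cons (f g : List P → ZMod 2) (p : P) (l : List P) :
    cup f g (p :: l) = f [p] * g (p :: l) + cup (fun t => f (p :: t)) g l := by
  simp [cup, Finset.sum_range_succ', add_comm]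

@[simp] theorem cupOne_nil (f g : List P → ZMod 2) : cupOne f g [] = 0 := by simp [cupOne]

@[simp] theorem cupOne_cons (f g : List P → ZMod 2) (p : P) (l : List P) :
    cupOne f g (p :: l) = cup (fun t => g (p :: t)) (fun t => f (p :: t)) l
      + cupOne (fun t => f (p :: t)) g l := by simp [cupOne]

theorem cobd_add (f g : List P → ZMod 2) (l : List P) :
    cobd (fun t => f t + g t) l = cobd f l + cobd g l := by
  simp [cobd, Finset.sum_add_distrib]

theorem cobd_smul (a : ZMod 2) (f : List P → ZMod 2) (l : List P) :
    cobd (fun t => a * f t) l = a * cobd f l := by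
  simp [cobd, Finset.mul_sum]

theorem cup_add_left (f f' g : List P → ZMod 2) (l : List P) :
    cup (fun t => f t + f' t) g l = cup f g l + cup f' g l := by
  simp [cup, add_mul, Finset.sum_add_distrib]

theorem cup_add_right (f g g' : List P → ZMod 2) (l : List P) :
    cup f (fun t => g t + g' t) l = cup f g l + cup f g' l := by
  simp [cup, mul_add, Finset.sum_add_distrib]

theorem cup_smul_left (a : ZMod 2) (f g : List P → ZMod 2) (l : List P) :
    cup (fun t => a * f t) g l = a * cup f g l := by
  simp [cup, Finset.mul_sum, mul_assoc]

theorem cobd_cobd (f : List P → ZMod 2) (l : List P) : cobd (cobd f) l = 0 := by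
  induction l generalizing f with
  | nil => simp
  | cons p l ih =>
    simp only [cobd_cons]
    rw [cobd_add, ih, add_zero, two_eq]

theorem cup_assoc (f g h : List P → ZMod 2) (l : List P) :
    cup (cup f g) h l = cup f (cup g h) l := by
  induction l generalizing f g with
  | nil => simp
  | cons p l ih =>
    simp only [cup_cons, cup_nil, add_zero]
    rw [cup_add_left, cup_smul_left, ih]
    ring

theorem unit_cup (g : List P → ZMod 2) (hg : g [] = 0) (l : List P) : cup unit g l = g l := by
  cases l with
  | nil => simp [hg]
  | cons p l =>
    simp only [cup_cons]
    have : cup (fun t => unit (p :: t)) g l = 0 := by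
      refine Finset.sum_eq_zero fun i hi => ?_
      have h := Finset.mem_range.1 hi
      have h' : (p :: List.take (i + 1) l).length ≠ 1 := by
        rw [List.length_cons, List.length_take]; omega
      simp only [unit]
      rw [if_neg h', zero_mul]
    rw [this]; simp [unit]

theorem cup_unit (f : List P → ZMod 2) (hf : f [] = 0) (l : List P) : cup f unit l = f l := by
  induction l generalizing f with
  | nil => simp [hf]
  | cons p l ih =>
    cases l with
    | nil => simp [unit]
    | cons q l =>
      have h0 := ih (fun t => if t = [] then 0 else f (p :: t)) (by simp)
      have h1 : cup (fun t => f (p :: t)) unit (q :: l)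
          = cup (fun t => if t = [] then 0 else f (p :: t)) unit (q :: l) := by
        refine Finset.sum_congr rfl fun i _ => ?_
        simp
      rw [cup_cons, h1, h0]
      simp [unit]

/-- The Leibniz rule (with the correction terms of functions that do not vanish on `[]`). -/
theorem cobd_cup (f g : List P → ZMod 2) (l : List P) :
    cobd (cup f g) l = cup (cobd f) g l + cup f (cobd g) l + (f [] * g l + g [] * f l) := by
  induction l generalizing f with
  | nil => simp; rw [mul_comm, two_eq]
  | cons p l ih =>
    simp only [cobd_cons, cup_cons, cobd_nil, add_zero]
    rw [cobd_add, cobd_smul, ih, cup_add_left]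
    linear_combination (-1 : ZMod 2) * two_eq (f [] * g (p :: l))

theorem cobd_cupOne (f g : List P → ZMod 2) (l : List P) :
    cobd (cupOne f g) l + cupOne (cobd f) g l + cupOne f (cobd g) l = cup f g l + cup g f l := by
  induction l generalizing f with
  | nil => simp
  | cons p l ih =>
    have h := ih (fun t => f (p :: t))
    have key : ∀ (a b : List P → ZMod 2) (l : List P) (c : List P → ZMod 2),
        cupOne (fun t => a t + b t) c l = cupOne a c l + cupOne b c l := by
      intro a b l c
      induction l generalizing a b with
      | nil => simp
      | cons q l ih' => simp only [cupOne_cons, cup_add_right, ih']; ring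
    simp only [cobd_cons, cup_cons, cupOne_cons]
    rw [cobd_add, cobd_cup, key, cup_add_left, cup_add_right]
    have two : (2 : ZMod 2) = 0 := rfl
    linear_combination h + (cup g (fun t => f (p :: t)) l
      + cup (fun t => g (p :: t)) (cobd fun t => f (p :: t)) l
      + cup (cobd fun t => g (p :: t)) (fun t => f (p :: t)) l + cupOne f g l) * two

theorem cobd_unit (l : List P) : cobd (unit : List P → ZMod 2) l = 0 := by
  rcases l with _ | ⟨p, _ | ⟨q, _ | ⟨r, l⟩⟩⟩
  · simp
  · simp [unit]
  · simp [unit]; rfl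
  · refine Finset.sum_eq_zero fun i hi => ?_
    have h := Finset.mem_range.1 hi
    have : ((p :: q :: r :: l).eraseIdx i).length = l.length + 2 := by
      rw [List.length_eraseIdx_of_lt h]; simp
    simp [unit, this]

theorem cobd_map (φ : Q → P) (f : List P → ZMod 2) (l : List Q) :
    cobd f (l.map φ) = cobd (fun t => f (t.map φ)) l := by
  induction l generalizing f with
  | nil => simp
  | cons p l ih => simp [ih]

theorem cup_map (φ : Q → P) (f g : List P → ZMod 2) (l : List Q) :
    cup f g (l.map φ) = cup (fun t => f (t.map φ)) (fun t => g (t.map φ)) l := by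
  induction l generalizing f with
  | nil => simp
  | cons p l ih => simp [ih]

theorem cupOne_map (φ : Q → P) (f g : List P → ZMod 2) (l : List Q) :
    cupOne f g (l.map φ) = cupOne (fun t => f (t.map φ)) (fun t => g (t.map φ)) l := by
  induction l generalizing f with
  | nil => simp
  | cons p l ih => simp [ih, cup_map]

theorem cobd_eq_zero (f : List P → ZMod 2) (l : List P) (h : ∀ t, t.Sublist l → f t = 0) :
    cobd f l = 0 :=
  Finset.sum_eq_zero fun i _ => h _ (List.eraseIdx_sublist l i)

theorem cup_eq_zero_left (f g : List P → ZMod 2) (l : List P) (h : ∀ t, t.Sublist l → f t = 0) :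
    cup f g l = 0 :=
  Finset.sum_eq_zero fun i _ => by rw [h _ (List.take_sublist _ l), zero_mul]

theorem cup_eq_zero_right (f g : List P → ZMod 2) (l : List P) (h : ∀ t, t.Sublist l → g t = 0) :
    cup f g l = 0 :=
  Finset.sum_eq_zero fun i _ => by rw [h _ (List.drop_sublist _ l), mul_zero]

theorem cupOne_eq_zero_left (f g : List P → ZMod 2) (l : List P)
    (h : ∀ t, t.Sublist l → f t = 0) : cupOne f g l = 0 := by
  induction l generalizing f with
  | nil => simp
  | cons p l ih =>
    have h' : ∀ t, t.Sublist l → f (p :: t) = 0 := fun t ht => h _ (ht.cons_cons p)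
    rw [cupOne_cons, cup_eq_zero_right _ _ _ h', ih _ h', add_zero]

theorem cupOne_eq_zero_right (f g : List P → ZMod 2) (l : List P)
    (h : ∀ t, t.Sublist l → g t = 0) : cupOne f g l = 0 := by
  induction l generalizing f with
  | nil => simp
  | cons p l ih =>
    have h' : ∀ t, t.Sublist l → g (p :: t) = 0 := fun t ht => h _ (ht.cons_cons p)
    rw [cupOne_cons, cup_eq_zero_left _ _ _ h', ih _ (fun t ht => h t (ht.cons p)), add_zero]

end ListCochain

/-! ### Borel equivariant cohomology of a space with an action of a discrete group

Let the discrete group `K` act on the space `X`. A cochain of degree `m` is a `K`-invariant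
`𝔽₂`-valued function of lists `[(k₀, x₀), …, (kₘ, xₘ)]`: homogeneous bar cochains in the variables
`kᵢ`, Alexander–Spanier cochains in the variables `xᵢ`. Accordingly the functions that, for fixed
`k₀, …, kₘ`, vanish for `x₀, …, xₘ` near the diagonal of `X` are regarded as zero. The cohomology of
this complex is the cohomology `H^*_K(X; 𝔽₂)` of the Borel construction `EK ×_K X`. If `X` is a
point, it is the group cohomology `H^*(K; 𝔽₂)`, computed by homogeneous cochains. All degrees are
treated at once: an element of the ring below is a family of classes, one in each degree. -/

namespace EquivariantCohomology

open ListCochain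

section Construction

variable (K X : Type*) [Group K] [TopologicalSpace X] [MulAction K X]

/-- The `K`-invariant cochains. -/
def cochains : AddSubgroup (List (K × X) → ZMod 2) where
  carrier := {f | f [] = 0 ∧ ∀ (k : K) (l : List (K × X)), f (l.map (k • ·)) = f l}
  zero_mem' := ⟨rfl, fun _ _ => rfl⟩
  add_mem' := by
    rintro f g ⟨hf, hf'⟩ ⟨hg, hg'⟩
    exact ⟨by simp [hf, hg], fun k l => by simp only [Pi.add_apply, hf', hg']⟩
  neg_mem' := by
    rintro f ⟨hf, hf'⟩
    exact ⟨by simp [hf], fun k l => by simp only [Pi.neg_apply, hf']⟩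

variable {K X}

/-- `f` vanishes near the diagonal of `X`, for every fixed list of elements of `K`. -/
def LocallyZero (f : List (K × X) → ZMod 2) : Prop :=
  ∀ (ks : List K) (y : X), ∃ U ∈ nhds y, ∀ l : List (K × X),
    l.map Prod.fst = ks → (∀ p ∈ l, p.2 ∈ U) → f l = 0

theorem LocallyZero.sublist {f : List (K × X) → ZMod 2} (hf : LocallyZero f) (ks : List K) (y : X) :
    ∃ U ∈ nhds y, ∀ l : List (K × X), l.map Prod.fst = ks → (∀ p ∈ l, p.2 ∈ U) →
      ∀ t, t.Sublist l → f t = 0 := by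
  choose U hU hfU using fun js : List K => hf js y
  refine ⟨⋂ js ∈ {js | js ∈ ks.sublists}, U js,
    (Filter.biInter_mem (List.finite_toSet _)).2 fun js _ => hU js, ?_⟩
  intro l hl hlU t ht
  refine hfU (t.map Prod.fst) t rfl fun p hp => ?_
  have h1 := hlU p (ht.subset hp)
  simp only [Set.mem_iInter] at h1
  refine h1 _ ?_
  simp only [Set.mem_ofPred_eq, List.mem_sublists]
  exact hl ▸ ht.map _

theorem LocallyZero.of_sublist {f g : List (K × X) → ZMod 2} (hf : LocallyZero f)
    (h : ∀ l, (∀ t, t.Sublist l → f t = 0) → g l = 0) : LocallyZero g := fun ks y => by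
  obtain ⟨U, hU, hfU⟩ := hf.sublist ks y
  exact ⟨U, hU, fun l hl hlU => h l (hfU l hl hlU)⟩

theorem LocallyZero.zero : LocallyZero (fun _ : List (K × X) => 0) :=
  fun _ _ => ⟨Set.univ, Filter.univ_mem, fun _ _ _ => rfl⟩

theorem LocallyZero.add {f g : List (K × X) → ZMod 2} (hf : LocallyZero f) (hg : LocallyZero g) :
    LocallyZero (fun l => f l + g l) := fun ks y => by
  obtain ⟨U, hU, hfU⟩ := hf ks y
  obtain ⟨W, hW, hgW⟩ := hg ks y
  refine ⟨U ∩ W, Filter.inter_mem hU hW, fun l hl h => ?_⟩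
  change f l + g l = 0
  rw [hfU l hl fun p hp => (h p hp).1, hgW l hl fun p hp => (h p hp).2, add_zero]

/-- The coboundary of an invariant cochain. -/
def delta (f : cochains K X) : cochains K X :=
  ⟨cobd f.1, cobd_nil _, fun k l => by simp only [cobd_map, f.2.2]⟩

instance : Ring (cochains K X) :=
  { (inferInstance : AddCommGroup (cochains K X)) with
    mul := fun f g => ⟨cup f.1 g.1, cup_nil _ _, fun k l => by simp only [cup_map, f.2.2, g.2.2]⟩
    one := ⟨unit, rfl, fun k l => by simp [unit]⟩
    mul_assoc := fun f g h => Subtype.ext (funext fun l => cup_assoc f.1 g.1 h.1 l)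
    one_mul := fun f => Subtype.ext (funext fun l => unit_cup f.1 f.2.1 l)
    mul_one := fun f => Subtype.ext (funext fun l => cup_unit f.1 f.2.1 l)
    left_distrib := fun f g h => Subtype.ext (funext fun l => cup_add_right f.1 g.1 h.1 l)
    right_distrib := fun f g h => Subtype.ext (funext fun l => cup_add_left f.1 g.1 h.1 l)
    zero_mul := fun f => Subtype.ext (funext fun l => cup_eq_zero_left _ _ l fun _ _ => rfl)
    mul_zero := fun f => Subtype.ext (funext fun l => cup_eq_zero_right _ _ l fun _ _ => rfl) }

theorem delta_add (f g : cochains K X) : delta (f + g) = delta f + delta g :=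
  Subtype.ext (funext fun l => cobd_add f.1 g.1 l)

theorem delta_mul (f g : cochains K X) : delta (f * g) = delta f * g + f * delta g :=
  Subtype.ext (funext fun l => by
    have h := cobd_cup f.1 g.1 l
    rw [f.2.1, g.2.1, zero_mul, zero_mul, add_zero, add_zero] at h
    exact h)

theorem delta_delta (f : cochains K X) : delta (delta f) = 0 :=
  Subtype.ext (funext fun l => cobd_cobd f.1 l)

theorem delta_one : delta (1 : cochains K X) = 0 := Subtype.ext (funext fun l => cobd_unit l)

theorem add_self (f : cochains K X) : f + f = 0 :=
  Subtype.ext (funext fun l => two_eq (f.1 l))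

variable (K X)

/-- The two-sided ideal of locally zero cochains (as an additive subgroup). -/
def locallyZero : AddSubgroup (cochains K X) where
  carrier := {f | LocallyZero f.1}
  zero_mem' := LocallyZero.zero
  add_mem' := fun hf hg => hf.add hg
  neg_mem' := fun {f} hf => by
    have h : -f = f := neg_eq_of_add_eq_zero_left (add_self f)
    simpa only [h] using hf

variable {K X}

theorem delta_mem {f : cochains K X} (hf : f ∈ locallyZero K X) : delta f ∈ locallyZero K X :=
  LocallyZero.of_sublist hf fun l h => cobd_eq_zero _ l h

theorem mul_mem_of_left {f : cochains K X} (hf : f ∈ locallyZero K X) (g : cochains K X) :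
    f * g ∈ locallyZero K X :=
  LocallyZero.of_sublist hf fun l h => cup_eq_zero_left _ _ l h

theorem mul_mem_of_right (f : cochains K X) {g : cochains K X} (hg : g ∈ locallyZero K X) :
    f * g ∈ locallyZero K X :=
  LocallyZero.of_sublist hg fun l h => cup_eq_zero_right _ _ l h

variable (K X)

/-- The ring of cocycles: the coboundary is locally zero. -/
def cocycles : Subring (cochains K X) where
  carrier := {f | delta f ∈ locallyZero K X}
  zero_mem' := by
    have h : delta (0 : cochains K X) = 0 := by simpa using delta_add (0 : cochains K X) 0
    simp only [Set.mem_ofPred_eq, h, zero_mem]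
  one_mem' := by simp only [Set.mem_ofPred_eq, delta_one, zero_mem]
  add_mem' := fun {f g} hf hg => by
    simp only [Set.mem_ofPred_eq, delta_add] at *
    exact add_mem hf hg
  neg_mem' := fun {f} hf => by
    have h : -f = f := neg_eq_of_add_eq_zero_left (add_self f)
    simpa only [h] using hf
  mul_mem' := fun {f g} hf hg => by
    simp only [Set.mem_ofPred_eq, delta_mul] at *
    exact add_mem (mul_mem_of_left hf g) (mul_mem_of_right f hg)

/-- The ideal of coboundaries: the cocycles that differ from some `delta h` by a locally zero
cochain. -/
def coboundaries : Ideal (cocycles K X) where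
  carrier := {z | ∃ h : cochains K X, z.1 - delta h ∈ locallyZero K X}
  zero_mem' := ⟨0, by
    have h : delta (0 : cochains K X) = 0 := by simpa using delta_add (0 : cochains K X) 0
    simp [h, zero_mem]⟩
  add_mem' := by
    rintro z z' ⟨h, hh⟩ ⟨h', hh'⟩
    refine ⟨h + h', ?_⟩
    rw [delta_add]
    have := add_mem hh hh'
    rwa [sub_add_sub_comm] at this
  smul_mem' := by
    rintro y z ⟨h, hh⟩
    refine ⟨y.1 * h, ?_⟩
    have e : (y • z).1 - delta (y.1 * h) = y.1 * (z.1 - delta h) - delta y.1 * h := by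
      rw [delta_mul, mul_sub, smul_eq_mul, Subring.coe_mul]; abel
    rw [e]
    exact sub_mem (mul_mem_of_right _ hh) (mul_mem_of_left y.2 h)

instance : (coboundaries K X).IsTwoSided := ⟨by
  rintro z y ⟨h, hh⟩
  refine ⟨h * y.1, ?_⟩
  have e : (z * y).1 - delta (h * y.1) = (z.1 - delta h) * y.1 - h * delta y.1 := by
    rw [delta_mul, sub_mul, Subring.coe_mul]; abel
  rw [e]
  exact sub_mem (mul_mem_of_left hh _) (mul_mem_of_right h y.2)⟩

/-- The equivariant cohomology ring `H^*_K(X; 𝔽₂)` (the product over all degrees). -/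
def BorelCohomology : Type _ := cocycles K X ⧸ coboundaries K X

instance : Ring (BorelCohomology K X) :=
  inferInstanceAs (Ring (cocycles K X ⧸ coboundaries K X))

variable {K X}

/-- The class of a cocycle. -/
def cls : cocycles K X →+* BorelCohomology K X := Ideal.Quotient.mk (coboundaries K X)

theorem cls_surjective : Function.Surjective (cls : cocycles K X → BorelCohomology K X) :=
  Ideal.Quotient.mk_surjective

theorem cls_eq_iff (y z : cocycles K X) :
    cls y = cls z ↔ ∃ h : cochains K X, y.1 - z.1 - delta h ∈ locallyZero K X :=
  Ideal.Quotient.eq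

theorem cls_mul_comm (y z : cocycles K X) : cls y * cls z = cls z * cls y := by
  rw [← map_mul, ← map_mul, cls_eq_iff]
  refine ⟨⟨cupOne y.1.1 z.1.1, cupOne_nil _ _,
    fun k l => by simp only [cupOne_map, y.1.2.2, z.1.2.2]⟩, ?_⟩
  have h1 : LocallyZero (cupOne (cobd y.1.1) z.1.1) :=
    LocallyZero.of_sublist y.2 fun l h => cupOne_eq_zero_left _ _ l h
  have h2 : LocallyZero (cupOne y.1.1 (cobd z.1.1)) :=
    LocallyZero.of_sublist z.2 fun l h => cupOne_eq_zero_right _ _ l h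
  refine LocallyZero.of_sublist (h1.add h2) fun l h => ?_
  have h3 := h l (List.Sublist.refl l)
  have h4 := cobd_cupOne y.1.1 z.1.1 l
  have two : (2 : ZMod 2) = 0 := rfl
  change cup y.1.1 z.1.1 l - cup z.1.1 y.1.1 l - cobd (cupOne y.1.1 z.1.1) l = 0
  linear_combination h3 - h4 - cup z.1.1 y.1.1 l * two

instance : CommRing (BorelCohomology K X) :=
  { (inferInstance : Ring (BorelCohomology K X)) with
    mul_comm := fun a b => by
      obtain ⟨y, rfl⟩ := cls_surjective a
      obtain ⟨z, rfl⟩ := cls_surjective b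
      exact cls_mul_comm y z }

/-- `a` lies in `H^m_K(X)`: it is the class of a cocycle concentrated in degree `m`. -/
def IsHomogeneous (m : ℕ) (a : BorelCohomology K X) : Prop :=
  ∃ z : cocycles K X, cls z = a ∧ ∀ l : List (K × X), l.length ≠ m + 1 → z.1.1 l = 0

end Construction

section Pullback

variable {K L X Y : Type*} [Group K] [Group L] [TopologicalSpace X] [TopologicalSpace Y]
  [MulAction K X] [MulAction L Y]

/-- Pullback of cochains along a group homomorphism `φ` and a `φ`-equivariant map `u`. -/
def cochainPullback (φ : K →* L) (u : X → Y) (hu : ∀ (k : K) (x : X), u (k • x) = φ k • u x) :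
    cochains L Y →+* cochains K X where
  toFun f := ⟨fun l => f.1 (l.map fun p => (φ p.1, u p.2)), f.2.1, fun k l => by
    have h := f.2.2 (φ k) (l.map fun p => (φ p.1, u p.2))
    change f.1 _ = f.1 _
    rw [← h, List.map_map, List.map_map]
    refine congrArg f.1 (List.map_congr_left fun p _ => ?_)
    simp [hu]⟩
  map_zero' := rfl
  map_one' := Subtype.ext (funext fun l => by
    change unit _ = unit _
    simp [unit])
  map_add' _ _ := rfl
  map_mul' f g := Subtype.ext (funext fun l => cup_map _ f.1 g.1 l)

theorem cochainPullback_delta (φ : K →* L) (u : X → Y) (hu : ∀ (k : K) (x : X), u (k • x) = φ k • u x)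
    (f : cochains L Y) : delta (cochainPullback φ u hu f) = cochainPullback φ u hu (delta f) :=
  Subtype.ext (funext fun l => (cobd_map _ f.1 l).symm)

theorem cochainPullback_mem (φ : K →* L) (u : X → Y) (huc : Continuous u)
    (hu : ∀ (k : K) (x : X), u (k • x) = φ k • u x) {f : cochains L Y}
    (hf : f ∈ locallyZero L Y) : cochainPullback φ u hu f ∈ locallyZero K X := by
  intro ks y
  obtain ⟨U, hU, hfU⟩ := hf (ks.map φ) (u y)
  refine ⟨u ⁻¹' U, huc.continuousAt hU, fun l hl h => hfU _ ?_ ?_⟩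
  · rw [← hl, List.map_map, List.map_map]; rfl
  · intro p hp
    obtain ⟨q, hq, rfl⟩ := List.mem_map.1 hp
    exact h q hq

/-- The ring homomorphism `H^*_L(Y) → H^*_K(X)` induced by a group homomorphism `φ : K → L` and a
continuous `φ`-equivariant map `u : X → Y`. -/
def pullback (φ : K →* L) (u : X → Y) (huc : Continuous u)
    (hu : ∀ (k : K) (x : X), u (k • x) = φ k • u x) :
    BorelCohomology L Y →+* BorelCohomology K X :=
  Ideal.Quotient.lift (coboundaries L Y)
    ((cls : cocycles K X →+* BorelCohomology K X).comp
      (((cochainPullback φ u hu).comp (cocycles L Y).subtype).codRestrict (cocycles K X)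
        fun z => by
          change delta (cochainPullback φ u hu z.1) ∈ locallyZero K X
          rw [cochainPullback_delta]
          exact cochainPullback_mem φ u huc hu z.2))
    (by
      rintro z ⟨h, hh⟩
      rw [← map_zero cls, RingHom.comp_apply, cls_eq_iff]
      refine ⟨cochainPullback φ u hu h, ?_⟩
      rw [cochainPullback_delta]
      have := cochainPullback_mem φ u huc hu hh
      rw [map_sub] at this
      simpa using this)

end Pullback

end EquivariantCohomology

/-! ### Stiefel–Whitney classes of a real representation -/

/-- The mod 2 cohomology ring `H^*(G; 𝔽₂)` of a discrete group `G`. -/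
abbrev CohomologyRing (G : Type*) [Group G] : Type _ :=
  EquivariantCohomology.BorelCohomology G PUnit.{1}

noncomputable section

namespace StiefelWhitney

open EquivariantCohomology

variable {G : Type*} [Group G] {V : Type*} [AddCommGroup V] [Module ℝ V]

/-- The space `V ∖ {0}` of nonzero vectors of a representation. -/
def Punctured (_ρ : Representation ℝ G V) : Type _ := {v : V // v ≠ 0}

/-- `V ∖ {0}` has the topology induced by the usual (canonical) topology of the real vector
space `V`. -/
instance (ρ : Representation ℝ G V) : TopologicalSpace (Punctured ρ) :=
  TopologicalSpace.induced (fun v => v.1) (moduleTopology ℝ V)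

/-- The group `G × {±1}` acts on `V ∖ {0}` by `(g, ε) • v = ε ρ(g) v`. Its Borel construction is the
bundle of projective spaces `EG ×_G P(V)` over `BG`, up to homotopy. -/
instance (ρ : Representation ℝ G V) : MulAction (G × ℤˣ) (Punctured ρ) where
  smul k v := ⟨((k.2 : ℤ) : ℝ) • ρ k.1 v.1, by
    refine smul_ne_zero (by simp) fun h => v.2 ?_
    have := congrArg (ρ k.1⁻¹) h
    rwa [map_zero, ← Module.End.mul_apply, ← map_mul, inv_mul_cancel, map_one] at this⟩
  one_smul v := Subtype.ext (by
    change (((1 : ℤˣ) : ℤ) : ℝ) • ρ 1 v.1 = v.1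
    simp)
  mul_smul k k' v := Subtype.ext (by
    change (((k.2 * k'.2 : ℤˣ) : ℤ) : ℝ) • ρ (k.1 * k'.1) v.1
      = ((k.2 : ℤ) : ℝ) • ρ k.1 (((k'.2 : ℤ) : ℝ) • ρ k'.1 v.1)
    simp [mul_smul])

/-- The cochain of degree 1 whose value on `[(k₀, v₀), (k₁, v₁)]`, with `kᵢ = (gᵢ, εᵢ)`, is `0` if
`ε₀ = ε₁` and `1` otherwise. -/
def tautCochain (ρ : Representation ℝ G V) : List ((G × ℤˣ) × Punctured ρ) → ZMod 2
  | [p, q] => if p.1.2 = q.1.2 then 0 else 1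
  | _ => 0

/-- The class `x` of degree 1 that classifies the tautological real line bundle on `EG ×_G P(V)`;
it is pulled back from the generator of `H^1({±1}; 𝔽₂)`. -/
def tautClass (ρ : Representation ℝ G V) : BorelCohomology (G × ℤˣ) (Punctured ρ) :=
  cls ⟨⟨tautCochain ρ, rfl, fun k l => by
      rcases l with _ | ⟨p, _ | ⟨q, _ | ⟨r, l⟩⟩⟩ <;> simp [tautCochain]⟩, by
    have h : delta (⟨tautCochain ρ, rfl, fun k l => by
      rcases l with _ | ⟨p, _ | ⟨q, _ | ⟨r, l⟩⟩⟩ <;> simp [tautCochain]⟩ :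
        cochains (G × ℤˣ) (Punctured ρ)) = 0 := by
      refine Subtype.ext (funext fun l => ?_)
      change ListCochain.cobd (tautCochain ρ) l = 0
      rcases l with _ | ⟨p, _ | ⟨q, _ | ⟨r, _ | ⟨s, l⟩⟩⟩⟩
      · simp
      · simp [tautCochain]
      · simp [tautCochain]
      · simp only [ListCochain.cobd_cons, ListCochain.cobd_nil, tautCochain]
        generalize p.1.2 = a
        generalize q.1.2 = b
        generalize r.1.2 = c
        revert a b c
        decide
      · refine Finset.sum_eq_zero fun i hi => ?_
        have h := Finset.mem_range.1 hi
        have h' : ((p :: q :: r :: s :: l).eraseIdx i).length = l.length + 3 := by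
          rw [List.length_eraseIdx_of_lt h]; simp
        revert h'
        generalize (p :: q :: r :: s :: l).eraseIdx i = t
        rcases t with _ | ⟨p', _ | ⟨q', _ | ⟨r', t⟩⟩⟩ <;> simp [tautCochain]
    change delta _ ∈ locallyZero _ _
    rw [h]
    exact zero_mem _⟩

/-- The pullback `H^*(G) → H^*_{G × {±1}}(V ∖ {0}) = H^*(EG ×_G P(V))`. -/
def fromBase (ρ : Representation ℝ G V) :
    CohomologyRing G →+* BorelCohomology (G × ℤˣ) (Punctured ρ) :=
  pullback (MonoidHom.fst G ℤˣ) (fun _ => PUnit.unit) continuous_const fun _ _ => rfl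

/-- The family `w` is the family of Stiefel–Whitney classes of the real representation `ρ` of
dimension `d`, i.e. of the vector bundle `EG ×_G V` over `BG`: `w₀ = 1`, `wᵢ ∈ H^i(G; 𝔽₂)`, `wᵢ = 0`
for `i > d`, and the defining relation of the cohomology of the projective bundle,
`∑ᵢ wᵢ x^(d - i) = 0` in `H^*(EG ×_G P(V))`, holds. -/
structure IsStiefelWhitney (ρ : Representation ℝ G V) (w : ℕ → CohomologyRing G) : Prop where
  zero : w 0 = 1
  homogeneous : ∀ i, IsHomogeneous i (w i)
  eq_zero : ∀ i, Module.finrank ℝ V < i → w i = 0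
  relation : ∑ i ∈ Finset.range (Module.finrank ℝ V + 1),
    fromBase ρ (w i) * tautClass ρ ^ (Module.finrank ℝ V - i) = 0

/-- The Stiefel–Whitney classes `wᵢ(ρ)` of a finite-dimensional real representation. -/
def sw (ρ : Representation ℝ G V) : ℕ → CohomologyRing G :=
  Classical.epsilon (IsStiefelWhitney ρ)

/-- The total Stiefel–Whitney class `w(ρ) = w₀(ρ) + w₁(ρ) + ⋯ + w_d(ρ)`, `d = dim ρ`. -/
def totalSW (ρ : Representation ℝ G V) : CohomologyRing G :=
  ∑ i ∈ Finset.range (Module.finrank ℝ V + 1), sw ρ i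

end StiefelWhitney

/-! ### The group `C₂ⁿ` and its representations -/

namespace ElementaryAbelian

open StiefelWhitney

/-- The group `C₂ⁿ = {±1}ⁿ` of diagonal sign matrices. -/
abbrev C2 (n : ℕ) : Type := Fin n → ℤˣ

/-- The binary strings of length `n` with exactly `i` ones. -/
def strings (n i : ℕ) : Finset (Fin n → Fin 2) :=
  Finset.univ.filter fun a => ∑ j, (a j : ℕ) = i

/-- The linear character `sgn_a = ⨂ⱼ sgn^(aⱼ)` of `C₂ⁿ`, as a real representation. -/
def sgn {n : ℕ} (a : Fin n → Fin 2) : Representation ℝ (C2 n) ℝ where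
  toFun g := ((∏ j, ((g j : ℤ) : ℝ) ^ (a j : ℕ)) • LinearMap.id)
  map_one' := by ext; simp
  map_mul' g h := by
    ext
    simp [mul_pow, Finset.prod_mul_distrib, mul_comm]

/-- The representation `σ_i = ⨁_{a} sgn_a`, the sum over the strings `a` with exactly `i` ones. -/
def sigma (n i : ℕ) : Representation ℝ (C2 n) (⨁ _ : strings n i, ℝ) :=
  Representation.directSum fun a : strings n i => sgn a.1

/-- The representation `⨁_{i=0}^n c_i σ_i`. -/
def sumSigma (n : ℕ) (c : Fin (n + 1) → ℕ) :
    Representation ℝ (C2 n)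
      (⨁ p : (Σ i : Fin (n + 1), Fin (c i)), (⨁ _ : strings n (p.1 : ℕ), ℝ)) :=
  Representation.directSum fun p : (Σ i : Fin (n + 1), Fin (c i)) => sigma n (p.1 : ℕ)

/-- The element `h_k = diag(-1, …, -1, 1, …, 1)`, with `k` entries `-1`. -/
def hElt (n k : ℕ) : C2 n := fun j => if (j : ℕ) < k then -1 else 1

/-- The automorphism of `C₂ⁿ` that permutes the factors by `τ`. -/
def permute {n : ℕ} (τ : Equiv.Perm (Fin n)) : C2 n →* C2 n where
  toFun g := g ∘ τ
  map_one' := rfl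
  map_mul' _ _ := rfl

/-- A representation of `C₂ⁿ` is `S_n`-invariant if it is isomorphic to each of its twists by
permutations of the factors. -/
def IsSymInvariant {n : ℕ} {V : Type*} [AddCommGroup V] [Module ℝ V]
    (π : Representation ℝ (C2 n) V) : Prop :=
  ∀ τ : Equiv.Perm (Fin n), Nonempty (Representation.Equiv (MonoidHom.comp π (permute τ)) π)

/-- The class `v_j = w₁(sgn_{e_j}) ∈ H^1(C₂ⁿ)`. -/
def vClass {n : ℕ} (j : Fin n) : CohomologyRing (C2 n) := sw (sgn (Pi.single j 1)) 1

/-- `l · v = ∑ⱼ lⱼ vⱼ`. -/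
def dotV {n : ℕ} (l : Fin n → Fin 2) : CohomologyRing (C2 n) := ∑ j, (l j : ℕ) • vClass j

end ElementaryAbelian

end

/-! Representation theory. The projectors `2^{-n} ∑ sgn_l(g) π(g)` split any real representation of
`C₂ⁿ` into sign characters. Invariance under `S_n` makes the multiplicity of `sgn_l` depend only on
the number of ones of `l`, hence `π ≅ ⨁ cᵢσᵢ`, where `cᵢ` is the multiplicity of the character of
`1⋯10⋯0` with `i` ones. Orthogonality expresses `cᵢ` as a mean over `g`. If group elements are also
indexed by strings, the value of the character of `a` at the element of `b` is `(-1)^{a·b}`,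
symmetric in `a` and `b`; so the elements with `k` entries `-1` contribute exactly `χ_{σ_k}(h_i)
χ_π(h_k)`.

Stiefel–Whitney classes of a sum of characters `ψᵢ` of a finite group `G`. Existence: where the
`i`-th coordinate of `V` is nonzero, its sign trivializes the line bundle with class `x + ψᵢ`. These
open sets cover `V ∖ {0}`, so the Euler class `∏ (x + ψᵢ)` vanishes there, and its expansion in
powers of `x` is the defining relation (`prod_charClass_eq_zero`). Hence `w_k` is the `k`-th
elementary symmetric function of the `ψᵢ`, and the total class is `∏ (1 + ψᵢ)`.

Uniqueness: two solutions differ by a polynomial in `x` whose value in `H^*(G × {±1})` has degree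
`dim V` and dies on `V ∖ {0}`. By `eq_zero_or_eq_prod_of_fromPoint_eq_zero` that value is `0` or the
Euler class. Powers of `x` are independent over `H^*(G)` (`eval₂_inflate_injective`), and the
coefficient of `x^{dim V}` in the difference is `0`, so the solutions agree.

The kernel statement replaces the Gysin sequence by integration (`cls_eq_prod_mul`). If `f` bounds a
class `α` on `V ∖ {0}`, let `Z_k` be the integral of `f` over the sphere spanned by `e₀, …, e_k`, an
iterated double cone over two points. The hemisphere with apex `e_{k+1}` has boundary the
`k`-sphere, and elements negating `e_{k+1}` exchange it with the opposite one. This gives `[Z_k] =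
χ_{k+1} [Z_{k+1}]`, similarly `α = χ₀ [Z₀]`, so `α` is the product of all `χᵢ` with a class that has
degree `0` when `deg α = dim V`. Since `f` bounds only near the diagonal, the cones are cut into `N`
thin layers. -/

namespace ListCochain

/-! ### Chain homotopies between maps of vertices -/

variable {P Q : Type*}

/-- The prism operator between two maps of vertices:
`prism φ ψ f [p₀, …, pₘ] = ∑ᵢ f [φ p₀, …, φ pᵢ, ψ pᵢ, …, ψ pₘ]`. -/
def prism (φ ψ : Q → P) : (List P → ZMod 2) → List Q → ZMod 2
  | _, [] => 0
  | f, p :: l => f (φ p :: ψ p :: l.map ψ) + prism φ ψ (fun t => f (φ p :: t)) l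

@[simp] theorem prism_nil (φ ψ : Q → P) (f : List P → ZMod 2) : prism φ ψ f [] = 0 := rfl

@[simp] theorem prism_cons (φ ψ : Q → P) (f : List P → ZMod 2) (p : Q) (l : List Q) :
    prism φ ψ f (p :: l) = f (φ p :: ψ p :: l.map ψ) + prism φ ψ (fun t => f (φ p :: t)) l := rfl

theorem prism_add (φ ψ : Q → P) (f g : List P → ZMod 2) (l : List Q) :
    prism φ ψ (fun t => f t + g t) l = prism φ ψ f l + prism φ ψ g l := by
  induction l generalizing f g with
  | nil => simp
  | cons p l ih => simp only [prism_cons, ih]; ring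

theorem prism_map {Q' : Type*} (φ ψ : Q → P) (u : Q' → Q) (f : List P → ZMod 2) (l : List Q') :
    prism φ ψ f (l.map u) = prism (φ ∘ u) (ψ ∘ u) f l := by
  induction l generalizing f with
  | nil => simp
  | cons p l ih => simp [ih]

theorem prism_comp {P' : Type*} (φ ψ : Q → P) (u : P → P') (f : List P' → ZMod 2) (l : List Q) :
    prism φ ψ (fun t => f (t.map u)) l = prism (u ∘ φ) (u ∘ ψ) f l := by
  induction l generalizing f with
  | nil => simp
  | cons p l ih => simp [← ih (fun t => f (u (φ p) :: t))]

/-- The prism operator is a cochain homotopy. -/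
theorem cobd_prism (φ ψ : Q → P) (f : List P → ZMod 2) (l : List Q) :
    cobd (prism φ ψ f) l + prism φ ψ (cobd f) l = f (l.map φ) + f (l.map ψ) := by
  induction l generalizing f with
  | nil => simp [two_eq]
  | cons p l ih =>
    have h := ih (fun t => f (φ p :: t))
    have h' := cobd_map ψ (fun s => f (φ p :: ψ p :: s)) l
    simp only [cobd_cons, prism_cons, List.map_cons]
    rw [cobd_add, prism_add, ← h']
    have two : (2 : ZMod 2) = 0 := rfl
    linear_combination h + (prism φ ψ f l + f (φ p :: l.map ψ)
      + cobd (fun s => f (φ p :: ψ p :: s)) (l.map ψ)) * two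

/-- The prism only evaluates `f` on lists one longer than `l`, made of images of vertices of `l`;
vanishing conditions on support or degree therefore pass to the prism. -/
theorem prism_eq_zero (φ ψ : Q → P) (f : List P → ZMod 2) (l : List Q)
    (h : ∀ t : List P, (∀ p ∈ t, ∃ q ∈ l, p = φ q ∨ p = ψ q) → t.length = l.length + 1 → f t = 0) :
    prism φ ψ f l = 0 := by
  induction l generalizing f with
  | nil => simp
  | cons p l ih =>
    rw [prism_cons, h, ih, add_zero]
    · intro t ht hl
      refine h _ ?_ (by simp [hl])
      intro q hq
      rcases List.mem_cons.1 hq with rfl | hq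
      · exact ⟨p, by simp, Or.inl rfl⟩
      · obtain ⟨r, hr, h'⟩ := ht q hq
        exact ⟨r, List.mem_cons_of_mem _ hr, h'⟩
    · intro q hq
      simp only [List.mem_cons, List.mem_map] at hq
      rcases hq with rfl | rfl | ⟨r, hr, rfl⟩
      · exact ⟨p, by simp, Or.inl rfl⟩
      · exact ⟨p, by simp, Or.inr rfl⟩
      · exact ⟨r, List.mem_cons_of_mem _ hr, Or.inr rfl⟩
    · simp

theorem cobd_sum {ι : Type*} (s : Finset ι) (f : ι → List P → ZMod 2) (l : List P) :
    cobd (fun t => ∑ j ∈ s, f j t) l = ∑ j ∈ s, cobd (f j) l := by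
  simp only [cobd]
  rw [Finset.sum_comm]

/-- The component of degree `m` of a cochain. -/
def component (m : ℕ) (f : List P → ZMod 2) (l : List P) : ZMod 2 :=
  if l.length = m + 1 then f l else 0

theorem cobd_component (m : ℕ) (f : List P → ZMod 2) (l : List P) :
    cobd (component m f) l = component (m + 1) (cobd f) l := by
  rw [component]
  split_ifs with h
  · refine Finset.sum_congr rfl fun i hi => ?_
    exact if_pos (by rw [List.length_eraseIdx_of_lt (Finset.mem_range.1 hi), h]; rfl)
  · refine Finset.sum_eq_zero fun i hi => if_neg ?_
    have := Finset.mem_range.1 hi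
    rw [List.length_eraseIdx_of_lt this]
    omega

end ListCochain

namespace EquivariantCohomology

open ListCochain

/-! ### Homogeneous classes -/

section Homogeneous

variable {K X : Type*} [Group K] [TopologicalSpace X] [MulAction K X]

theorem add_self_eq_zero (a : BorelCohomology K X) : a + a = 0 := by
  obtain ⟨z, rfl⟩ := cls_surjective a
  rw [← map_add, ← map_zero cls]
  exact congrArg cls (Subtype.ext (add_self z.1))

theorem sub_eq_add (a b : BorelCohomology K X) : a - b = a + b := by
  rw [sub_eq_iff_eq_add, add_assoc, add_self_eq_zero, add_zero]

theorem IsHomogeneous.zero (m : ℕ) : IsHomogeneous m (0 : BorelCohomology K X) :=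
  ⟨0, map_zero _, fun _ _ => rfl⟩

theorem IsHomogeneous.one : IsHomogeneous 0 (1 : BorelCohomology K X) :=
  ⟨1, map_one _, fun _ h => if_neg h⟩

theorem IsHomogeneous.add {m : ℕ} {a b : BorelCohomology K X} (ha : IsHomogeneous m a)
    (hb : IsHomogeneous m b) : IsHomogeneous m (a + b) := by
  obtain ⟨y, rfl, hy⟩ := ha
  obtain ⟨z, rfl, hz⟩ := hb
  refine ⟨y + z, map_add _ _ _, fun l hl => ?_⟩
  change y.1.1 l + z.1.1 l = 0
  rw [hy l hl, hz l hl, add_zero]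

theorem IsHomogeneous.mul {m m' : ℕ} {a b : BorelCohomology K X} (ha : IsHomogeneous m a)
    (hb : IsHomogeneous m' b) : IsHomogeneous (m + m') (a * b) := by
  obtain ⟨y, rfl, hy⟩ := ha
  obtain ⟨z, rfl, hz⟩ := hb
  refine ⟨y * z, map_mul _ _ _, fun l hl => ?_⟩
  change cup y.1.1 z.1.1 l = 0
  refine Finset.sum_eq_zero fun i hi => ?_
  have hi := Finset.mem_range.1 hi
  by_cases h : i = m
  · rw [hz _ (by rw [List.length_drop]; omega), mul_zero]
  · rw [hy _ (by rw [List.length_take]; omega), zero_mul]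

theorem IsHomogeneous.sum {ι : Type*} {m : ℕ} (s : Finset ι) {a : ι → BorelCohomology K X}
    (h : ∀ i ∈ s, IsHomogeneous m (a i)) : IsHomogeneous m (∑ i ∈ s, a i) := by
  classical
  induction s using Finset.induction_on with
  | empty => rw [Finset.sum_empty]; exact .zero m
  | insert i s hi ih =>
    rw [Finset.sum_insert hi]
    exact (h i (by simp)).add (ih fun j hj => h j (by simp [hj]))

theorem IsHomogeneous.prod {ι : Type*} (s : Finset ι) {a : ι → BorelCohomology K X}
    (h : ∀ i ∈ s, IsHomogeneous 1 (a i)) : IsHomogeneous s.card (∏ i ∈ s, a i) := by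
  classical
  induction s using Finset.induction_on with
  | empty => simpa using IsHomogeneous.one
  | insert i s hi ih =>
    rw [Finset.prod_insert hi, Finset.card_insert_of_notMem hi, add_comm]
    exact (h i (by simp)).mul (ih fun j hj => h j (by simp [hj]))

theorem IsHomogeneous.pow {m : ℕ} {a : BorelCohomology K X} (h : IsHomogeneous m a) (k : ℕ) :
    IsHomogeneous (k * m) (a ^ k) := by
  induction k with
  | zero => simpa using IsHomogeneous.one
  | succ k ih => rw [pow_succ, add_mul, one_mul]; exact ih.mul h

theorem IsHomogeneous.pullback {L Y : Type*} [Group L] [TopologicalSpace Y] [MulAction L Y]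
    (φ : K →* L) (u : X → Y) (huc : Continuous u) (hu : ∀ (k : K) (x : X), u (k • x) = φ k • u x)
    {m : ℕ} {a : BorelCohomology L Y} (h : IsHomogeneous m a) :
    IsHomogeneous m (pullback φ u huc hu a) := by
  obtain ⟨z, rfl, hz⟩ := h
  exact ⟨_, rfl, fun l hl => hz _ (by simpa using hl)⟩

end Homogeneous

/-! ### Cohomology of a point -/

section Point

variable {K : Type*} [Group K]

/-- Every neighbourhood of the point contains it, so over a point cocycles and coboundaries are
honest ones. -/
theorem locallyZero_point {f : List (K × PUnit.{1}) → ZMod 2} (h : LocallyZero f) : f = 0 := by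
  funext l
  obtain ⟨U, hU, hf⟩ := h (l.map Prod.fst) PUnit.unit
  exact hf l rfl fun p _ => mem_of_mem_nhds hU

theorem cls_point_eq_iff (y z : cocycles K PUnit.{1}) :
    cls y = cls z ↔ ∃ h : cochains K PUnit.{1}, y.1 = z.1 + delta h := by
  rw [cls_eq_iff]
  refine exists_congr fun h => ⟨fun H => ?_, fun H => ?_⟩
  · have : y.1 - z.1 - delta h = 0 := Subtype.ext (locallyZero_point H)
    rwa [sub_sub, sub_eq_zero] at this
  · rw [H, add_sub_cancel_left, sub_self]; exact zero_mem _

theorem cobd_cocycle_point (z : cocycles K PUnit.{1}) (l : List (K × PUnit.{1})) :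
    cobd z.1.1 l = 0 := congrFun (locallyZero_point z.2) l

end Point

/-! ### Degree-one classes of characters -/

section Character

variable {K : Type*} [Group K]

/-- The cochain `[k₀, k₁] ↦ [χ k₀ ≠ χ k₁]`, on the functions of lists. -/
def charFun {X : Type*} (χ : K →* ℤˣ) : List (K × X) → ZMod 2
  | [p, q] => if χ p.1 = χ q.1 then 0 else 1
  | _ => 0

/-- The function `k ↦ [χ k ≠ 1]` in degree `0`. -/
def indicator {X : Type*} (χ : K →* ℤˣ) : List (K × X) → ZMod 2
  | [p] => if χ p.1 = 1 then 0 else 1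
  | _ => 0

/-- Without the invariance condition the character cocycle bounds; the failure of `indicator χ` to
be invariant is what the arguments below exploit. -/
theorem cobd_indicator {X : Type*} (χ : K →* ℤˣ) (l : List (K × X)) :
    cobd (indicator χ) l = charFun χ l := by
  rcases l with _ | ⟨p, _ | ⟨q, _ | ⟨r, l⟩⟩⟩
  · simp [charFun]
  · simp [charFun, indicator]
  · simp only [cobd_cons, cobd_nil, indicator, charFun]
    generalize χ p.1 = a
    generalize χ q.1 = b
    revert a b
    decide
  · refine Finset.sum_eq_zero fun i hi => ?_
    have h := Finset.mem_range.1 hi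
    have h' : ((p :: q :: r :: l).eraseIdx i).length = l.length + 2 := by
      rw [List.length_eraseIdx_of_lt h]; simp
    revert h'
    generalize (p :: q :: r :: l).eraseIdx i = t
    rcases t with _ | ⟨p', _ | ⟨q', t⟩⟩ <;> simp [indicator]

theorem cobd_charFun {X : Type*} (χ : K →* ℤˣ) (l : List (K × X)) :
    cobd (charFun χ) l = 0 := by
  rw [show (charFun χ : List (K × X) → ZMod 2) = cobd (indicator χ) from
    funext fun l => (cobd_indicator χ l).symm, cobd_cobd]

/-- The cocycle `[k₀, k₁] ↦ [χ k₀ ≠ χ k₁]`. -/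
def charCocycle (X : Type*) [TopologicalSpace X] [MulAction K X] (χ : K →* ℤˣ) : cocycles K X :=
  ⟨⟨charFun χ, rfl, fun k l => by
      rcases l with _ | ⟨p, _ | ⟨q, _ | ⟨r, l⟩⟩⟩ <;> simp [charFun]⟩, by
    have h : delta (⟨charFun χ, rfl, fun k l => by
      rcases l with _ | ⟨p, _ | ⟨q, _ | ⟨r, l⟩⟩⟩ <;> simp [charFun]⟩ :
        cochains K X) = 0 := Subtype.ext (funext fun l => cobd_charFun χ l)
    change delta _ ∈ locallyZero _ _
    rw [h]
    exact zero_mem _⟩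

/-- The class in `H^1_K(X; 𝔽₂)` of a character `χ : K → {±1}`. -/
def charClass (X : Type*) [TopologicalSpace X] [MulAction K X] (χ : K →* ℤˣ) :
    BorelCohomology K X := cls (charCocycle X χ)

variable {X : Type*} [TopologicalSpace X] [MulAction K X]

theorem charClass_mul (χ ψ : K →* ℤˣ) :
    charClass X (χ * ψ) = charClass X χ + charClass X ψ := by
  rw [charClass, charClass, charClass, ← map_add]
  refine congrArg cls (Subtype.ext (Subtype.ext (funext fun l => ?_)))
  change charFun (χ * ψ) l = charFun χ l + charFun ψ l
  rcases l with _ | ⟨p, _ | ⟨q, _ | ⟨r, l⟩⟩⟩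
  · simp [charFun]
  · simp [charFun]
  · have key : ∀ a b c d : ℤˣ, (if a * c = b * d then (0 : ZMod 2) else 1)
        = (if a = b then 0 else 1) + if c = d then 0 else 1 := by decide
    exact key _ _ _ _
  · simp [charFun]

theorem charClass_one : charClass X (1 : K →* ℤˣ) = 0 := by
  have h := charClass_mul (X := X) (1 : K →* ℤˣ) 1
  rw [mul_one] at h
  simpa using h

theorem isHomogeneous_charClass (χ : K →* ℤˣ) : IsHomogeneous 1 (charClass X χ) := by
  refine ⟨_, rfl, fun l hl => ?_⟩
  change charFun χ l = 0
  rcases l with _ | ⟨p, _ | ⟨q, _ | ⟨r, l⟩⟩⟩ <;> simp [charFun] at hl ⊢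

theorem pullback_charClass {L Y : Type*} [Group L] [TopologicalSpace Y] [MulAction L Y]
    (φ : K →* L) (u : X → Y) (huc : Continuous u) (hu : ∀ (k : K) (x : X), u (k • x) = φ k • u x)
    (χ : L →* ℤˣ) : pullback φ u huc hu (charClass Y χ) = charClass X (χ.comp φ) := by
  refine congrArg cls (Subtype.ext (Subtype.ext (funext fun l => ?_)))
  change charFun χ (l.map fun p => (φ p.1, u p.2)) = charFun (χ.comp φ) l
  rcases l with _ | ⟨p, _ | ⟨q, _ | ⟨r, l⟩⟩⟩ <;> simp [charFun]

end Character

end EquivariantCohomology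

namespace EquivariantCohomology

open ListCochain

/-! ### Multiplication by the class of a character -/

section Step

variable {K : Type*} [Group K]

/-- As `indicator χ` has degree `0`, the product multiplies `g` by its value at the first vertex,
and translation by `s` shifts that value by the constant `[χ s ≠ 1]`. -/
theorem cup_eq_add_cup_smul (χ : K →* ℤˣ) (g : List (K × PUnit.{1}) → ZMod 2) (hg : g [] = 0)
    (hinv : ∀ (k : K) (l : List (K × PUnit.{1})), g (l.map (k • ·)) = g l) (s : K)
    (l : List (K × PUnit.{1})) :
    cup (indicator χ) g (l.map (s • ·))
      = cup (indicator χ) g l + (if χ s = 1 then 0 else g l) := by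
  have key : ∀ p : K × PUnit.{1},
      (indicator χ [s • p] : ZMod 2) = indicator χ [p] + if χ s = 1 then 0 else 1 := by
    intro p
    have h : ∀ a b : ℤˣ, (if a * b = 1 then (0 : ZMod 2) else 1)
        = (if b = 1 then 0 else 1) + if a = 1 then 0 else 1 := by decide
    simpa [indicator] using h (χ s) (χ p.1)
  have zero : ∀ (p : K × PUnit.{1}) (l : List (K × PUnit.{1})),
      cup (fun t => indicator χ (p :: t)) g l = 0 := by
    intro p l
    refine Finset.sum_eq_zero fun i hi => ?_
    have hi := Finset.mem_range.1 hi
    rcases l with _ | ⟨q, l⟩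
    · simp at hi
    · simp [indicator]
  rcases l with _ | ⟨p, l⟩
  · simp [hg]
  · rw [List.map_cons, cup_cons, cup_cons, zero, zero, add_zero, add_zero, key,
      ← List.map_cons (f := (s • · : K × PUnit.{1} → _)), hinv, add_mul]
    split_ifs <;> simp

/-- If the function `p` on a group with a character `χ` is invariant under `ker χ`, differs from
its other translates by the cocycle `R`, and has the coboundary `z`, then `z` is cohomologous to
`χ ∪ R`. -/
theorem cls_eq_charClass_mul (χ : K →* ℤˣ) (p : List (K × PUnit.{1}) → ZMod 2) (hp : p [] = 0)
    (R z : cocycles K PUnit.{1})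
    (hinv : ∀ (s : K) (l : List (K × PUnit.{1})),
      p (l.map (s • ·)) = p l + (if χ s = 1 then 0 else R.1.1 l))
    (hz : ∀ l, cobd p l = z.1.1 l) : cls z = charClass _ χ * cls R := by
  rw [charClass, ← map_mul, cls_point_eq_iff]
  -- Both summands fail to be invariant by the same term, so the sum is an invariant cochain; its
  -- coboundary is `z + χ ∪ R`.
  refine ⟨⟨fun l => p l + cup (indicator χ) R.1.1 l, by simp [hp], fun s l => ?_⟩, ?_⟩
  · simp only
    rw [hinv, cup_eq_add_cup_smul χ R.1.1 R.1.2.1 R.1.2.2]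
    linear_combination two_eq (if χ s = 1 then 0 else R.1.1 l)
  · refine Subtype.ext (funext fun l => ?_)
    change z.1.1 l = cup (charFun χ) R.1.1 l
      + cobd (fun l => p l + cup (indicator χ) R.1.1 l) l
    rw [cobd_add, hz, cobd_cup, R.1.2.1,
      show (cobd (indicator χ) : List (K × PUnit.{1}) → ZMod 2) = charFun χ from
        funext fun l => cobd_indicator χ l,
      show cobd R.1.1 = fun _ => 0 from funext fun l => cobd_cocycle_point R l,
      cup_eq_zero_right _ _ _ fun _ _ => rfl]
    simp only [indicator]
    linear_combination (-1 : ZMod 2) * two_eq (cup (charFun χ) R.1.1 l)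

variable {G : Type*} [Group G]

/-- Multiplication by the class of the sign character is injective on `H^*(G × {±1}; 𝔽₂)`. -/
theorem charClass_snd_mul_injective (b : CohomologyRing (G × ℤˣ))
    (hb : charClass _ (MonoidHom.snd G ℤˣ) * b = 0) : b = 0 := by
  obtain ⟨z, rfl⟩ := cls_surjective b
  set χ := MonoidHom.snd G ℤˣ with hχ
  rw [charClass, ← map_mul, ← map_zero cls, cls_point_eq_iff] at hb
  obtain ⟨q, hq⟩ := hb
  have hq' : ∀ l, cup (charFun χ) z.1.1 l = cobd q.1 l := fun l => by
    have : _ = 0 + cobd q.1 l := congrFun (congrArg Subtype.val hq) l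
    rwa [zero_add] at this
  let θ : (G × ℤˣ) × PUnit.{1} → (G × ℤˣ) × PUnit.{1} := fun p => ((p.1.1, 1), p.2)
  let r : List ((G × ℤˣ) × PUnit.{1}) → ZMod 2 := fun l => cup (indicator χ) z.1.1 l + q.1 l
  have hr : ∀ (s : G × ℤˣ) l, r (l.map (s • ·)) = r l + if s.2 = 1 then 0 else z.1.1 l := by
    intro s l
    simp only [r]
    rw [cup_eq_add_cup_smul χ z.1.1 z.1.2.1 z.1.2.2, q.2.2, hχ]
    exact add_right_comm _ _ _
  have hδ : ∀ l, cobd r l = 0 := by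
    intro l
    simp only [r]
    rw [cobd_add, cobd_cup, z.1.2.1,
      show (cobd (indicator χ) : List ((G × ℤˣ) × PUnit.{1}) → ZMod 2) = charFun χ from
        funext fun l => cobd_indicator χ l, hq',
      show cobd z.1.1 = fun _ => 0 from funext fun l => cobd_cocycle_point z l,
      cup_eq_zero_right _ _ _ fun _ _ => rfl]
    simp only [indicator]
    linear_combination two_eq (cobd q.1 l)
  -- The homotopy from `θ` to the identity, applied to the cocycle `r`: a `G`-invariant cochain with
  -- coboundary `r ∘ θ + r`.
  let w : List ((G × ℤˣ) × PUnit.{1}) → ZMod 2 := prism θ id r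
  have hw : ∀ l, cobd w l = r (l.map θ) + r l := by
    intro l
    have := cobd_prism θ id r l
    rw [show cobd r = fun _ => 0 from funext hδ, prism_eq_zero _ _ _ _ fun _ _ _ => rfl] at this
    simpa using this
  have hwinv : ∀ (g : G) l, w (l.map ((g, (1 : ℤˣ)) • ·)) = w l := by
    intro g l
    simp only [w]
    rw [prism_map]
    have := prism_comp θ id ((g, (1 : ℤˣ)) • · : (G × ℤˣ) × PUnit.{1} → _) r l
    rw [show (fun t : List ((G × ℤˣ) × PUnit.{1}) => r (t.map ((g, (1 : ℤˣ)) • ·))) = r from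
      funext fun t => by rw [hr, if_pos rfl, add_zero]] at this
    rw [this]
    congr 1
  let T : (G × ℤˣ) × PUnit.{1} → (G × ℤˣ) × PUnit.{1} := (((1 : G), (-1 : ℤˣ)) • ·)
  have hTT : ∀ l : List ((G × ℤˣ) × PUnit.{1}), (l.map T).map T = l := by
    intro l
    rw [List.map_map]
    convert List.map_id l
    funext p
    simp only [T, Function.comp, smul_smul, Prod.mk_mul_mk, one_mul, mul_neg]
    exact one_smul (G × ℤˣ) p
  rw [← map_zero cls, cls_point_eq_iff]
  -- Symmetrization over `{±1}` restores full invariance. As `θ ∘ T = θ`, the terms `r ∘ θ` cancel,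
  -- and the coboundary is `r + r ∘ T = z`.
  refine ⟨⟨fun l => w l + w (l.map T), by simp [w], fun s l => ?_⟩, ?_⟩
  · simp only
    have h1 : (l.map (s • ·)).map T = (l.map T).map (s • ·) := by
      rw [List.map_map, List.map_map]
      refine List.map_congr_left fun p _ => ?_
      simp only [T, Function.comp, smul_smul]
      congr 1
      simp [Prod.ext_iff, mul_comm]
    rw [h1]
    rcases Int.units_eq_one_or s.2 with h | h
    · rw [show s = (s.1, 1) from Prod.ext rfl h, hwinv, hwinv]
    · have h2 : ∀ l : List ((G × ℤˣ) × PUnit.{1}), w (l.map (s • ·)) = w (l.map T) := by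
        intro l
        rw [← hwinv s.1 (l.map T), List.map_map]
        congr 1
        refine List.map_congr_left fun p _ => ?_
        simp only [T, Function.comp, smul_smul]
        congr 1
        simp [Prod.ext_iff, h]
      rw [h2, h2, hTT, add_comm]
  · refine Subtype.ext (funext fun l => ?_)
    change z.1.1 l = 0 + cobd (fun l => w l + w (l.map T)) l
    rw [cobd_add, hw, ← cobd_map, hw]
    have h3 : (l.map T).map θ = l.map θ := by
      rw [List.map_map]
      refine List.map_congr_left fun p _ => ?_
      simp [T, θ]
    have h4 := hr (1, -1) l
    rw [if_neg (show ¬(-1 : ℤˣ) = 1 by decide)] at h4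
    change r (l.map T) = _ at h4
    rw [h3, h4]
    linear_combination (-1 : ZMod 2) * (two_eq (r (l.map θ)) + two_eq (r l))

end Step

/-! ### Independence of the powers of `x` over `H^*(G)` -/

section Polynomial

open Polynomial

variable {G : Type*} [Group G]

/-- The inflation homomorphism `H^*(G) → H^*(G × {±1})`. -/
def inflate : CohomologyRing G →+* CohomologyRing (G × ℤˣ) :=
  pullback (MonoidHom.fst G ℤˣ) (fun _ => PUnit.unit) continuous_const fun _ _ => rfl

/-- The powers of the class of the sign character are linearly independent over `H^*(G)`. -/
theorem eval₂_inflate_injective (P : (CohomologyRing G)[X])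
    (hP : P.eval₂ inflate (charClass _ (MonoidHom.snd G ℤˣ)) = 0) : P = 0 := by
  induction hn : P.natDegree using Nat.strong_induction_on generalizing P with
  | _ n ih =>
    -- Restriction to `G × 1` is a left inverse of inflation and kills `x`, so it isolates the
    -- constant coefficient. That coefficient being `0`, one factor `x` can be cancelled and the
    -- degree drops.
    let res : CohomologyRing (G × ℤˣ) →+* CohomologyRing G :=
      pullback (MonoidHom.inl G ℤˣ) (fun _ => PUnit.unit) continuous_const fun _ _ => rfl
    have h1 : ∀ a, res (inflate a) = a := by
      intro a
      obtain ⟨z, rfl⟩ := cls_surjective a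
      refine congrArg cls (Subtype.ext (Subtype.ext (funext fun l => ?_)))
      change z.1.1 (List.map _ (List.map _ l)) = z.1.1 l
      rw [List.map_map]
      exact congrArg z.1.1 ((List.map_congr_left fun p _ => rfl).trans (List.map_id l))
    have h2 : res (charClass _ (MonoidHom.snd G ℤˣ)) = 0 := by
      rw [pullback_charClass]
      exact charClass_one
    have h3 := hP
    rw [← divX_mul_X_add P, eval₂_add, eval₂_mul, eval₂_C, eval₂_X] at h3
    have h4 : P.coeff 0 = 0 := by
      have := congrArg res h3
      rwa [map_add, map_mul, h1, h2, mul_zero, zero_add, map_zero] at this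
    rw [h4, map_zero, add_zero, mul_comm] at h3
    have h5 := charClass_snd_mul_injective _ h3
    by_cases h0 : P.natDegree = 0
    · rw [eq_C_of_natDegree_eq_zero h0, h4, C_0]
    · have h6 := ih _ (by rw [← hn, natDegree_divX_eq_natDegree_tsub_one]; omega) P.divX h5 rfl
      rw [← divX_mul_X_add P, h6, h4, zero_mul, C_0, add_zero]

end Polynomial

end EquivariantCohomology

namespace EquivariantCohomology

open ListCochain

/-! ### Integration over small spheres and hemispheres -/

section Integration

variable {K E : Type*} [Group K] [AddCommGroup E] [Module ℝ E]

/-- The map that moves a vector by the ratio `1 - t` towards the apex `x`. -/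
def slide (x : E) (t : ℝ) (p : K × E) : K × E := (p.1, (1 - t) • x + t • p.2)

/-- The value of a cochain on the cone with apex `x`, which is divided into `N` layers. -/
noncomputable def coneOff (N : ℕ) (x : E) (f : List (K × E) → ZMod 2) (l : List (K × E)) : ZMod 2 :=
  ∑ j ∈ Finset.range N, prism (slide x (j / N)) (slide x ((j + 1 : ℕ) / N)) f l

/-- Restriction of a cochain to the point `x`. -/
def atPoint (x : E) (f : List (K × E) → ZMod 2) (l : List (K × PUnit.{1})) : ZMod 2 :=
  f (l.map fun p => (p.1, x))

/-- Integration over the sphere in the span of `e 0, …, e k`. -/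
noncomputable def sphereInt (N : ℕ) (e : ℕ → E) :
    ℕ → (List (K × E) → ZMod 2) → List (K × PUnit.{1}) → ZMod 2
  | 0, f, l => atPoint (e 0) f l + atPoint (-e 0) f l
  | k + 1, f, l =>
    sphereInt N e k (fun t => coneOff N (e (k + 1)) f t + coneOff N (-e (k + 1)) f t) l

/-- Integration over the cone with apex `x` over the sphere in the span of `e 0, …, e (k - 1)`. -/
noncomputable def hemiInt (N : ℕ) (e : ℕ → E) :
    ℕ → E → (List (K × E) → ZMod 2) → List (K × PUnit.{1}) → ZMod 2
  | 0, x, f, l => atPoint x f l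
  | k + 1, x, f, l => sphereInt N e k (coneOff N x f) l

theorem coneOff_add (N : ℕ) (x : E) (f g : List (K × E) → ZMod 2) (l : List (K × E)) :
    coneOff N x (fun t => f t + g t) l = coneOff N x f l + coneOff N x g l := by
  simp only [coneOff, prism_add, Finset.sum_add_distrib]

theorem sphereInt_add (N : ℕ) (e : ℕ → E) (k : ℕ) (f g : List (K × E) → ZMod 2)
    (l : List (K × PUnit.{1})) :
    sphereInt N e k (fun t => f t + g t) l = sphereInt N e k f l + sphereInt N e k g l := by
  induction k generalizing f g with
  | zero => simp only [sphereInt, atPoint]; ring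
  | succ k ih =>
    simp only [sphereInt]
    rw [← ih]
    congr 1
    funext t
    rw [coneOff_add, coneOff_add]
    ring

theorem sphereInt_zero (N : ℕ) (e : ℕ → E) (k : ℕ) (l : List (K × PUnit.{1})) :
    sphereInt N e k (fun _ => 0) l = 0 := by
  have h := sphereInt_add N e k (fun _ => 0) (fun _ => 0) l
  simp only [add_zero] at h
  rw [h, two_eq]

theorem hemiInt_add (N : ℕ) (e : ℕ → E) (k : ℕ) (x : E) (f g : List (K × E) → ZMod 2)
    (l : List (K × PUnit.{1})) :
    hemiInt N e k x (fun t => f t + g t) l = hemiInt N e k x f l + hemiInt N e k x g l := by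
  cases k with
  | zero => rfl
  | succ k =>
    simp only [hemiInt]
    rw [← sphereInt_add]
    congr 1
    funext t
    rw [coneOff_add]

theorem sphereInt_eq_add (N : ℕ) (e : ℕ → E) (k : ℕ) (f : List (K × E) → ZMod 2)
    (l : List (K × PUnit.{1})) :
    sphereInt N e k f l = hemiInt N e k (e k) f l + hemiInt N e k (-e k) f l := by
  cases k with
  | zero => rfl
  | succ k =>
    simp only [hemiInt]
    rw [← sphereInt_add, sphereInt]

theorem sum_range_add_succ (F : ℕ → ZMod 2) (N : ℕ) :
    ∑ j ∈ Finset.range N, (F j + F (j + 1)) = F 0 + F N := by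
  induction N with
  | zero => simp [two_eq]
  | succ N ih => rw [Finset.sum_range_succ, ih]; linear_combination two_eq (F N)

/-- The homotopies of consecutive layers telescope; ratio `0` collapses everything to the apex and
ratio `1` is the identity. Every `N ≠ 0` gives this formula; its size only matters for the
diameters. -/
theorem cobd_coneOff {N : ℕ} (hN : N ≠ 0) (x : E) (f : List (K × E) → ZMod 2)
    (l : List (K × E)) :
    cobd (coneOff N x f) l
      = coneOff N x (cobd f) l + (f l + f (l.map fun p => (p.1, x))) := by
  have h : cobd (coneOff N x f) l + coneOff N x (cobd f) l
      = f (l.map fun p => (p.1, x)) + f l := by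
    have hs := cobd_sum (Finset.range N)
      (fun j : ℕ => prism (slide x (j / N)) (slide x ((j + 1 : ℕ) / N)) f) l
    change cobd (coneOff N x f) l = _ at hs
    rw [hs, coneOff, ← Finset.sum_add_distrib]
    simp only [cobd_prism]
    rw [sum_range_add_succ (fun j => f (l.map (slide x (j / N))))]
    have h0 : (slide x ((0 : ℕ) / (N : ℝ)) : K × E → K × E) = fun p => (p.1, x) := by
      funext p; simp [slide]
    have h1 : (slide x ((N : ℕ) / (N : ℝ)) : K × E → K × E) = id := by
      funext p
      rw [div_self (by exact_mod_cast hN)]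
      simp [slide]
    simp only [h0, h1, List.map_id]
  linear_combination h - two_eq (coneOff N x (cobd f) l)

/-- An invariant function on lists with zero coboundary, as a cocycle of the group. -/
def pointCocycle (g : List (K × PUnit.{1}) → ZMod 2) (h0 : g [] = 0)
    (hinv : ∀ (s : K) (l : List (K × PUnit.{1})), g (l.map (s • ·)) = g l)
    (hg : ∀ l, cobd g l = 0) : cocycles K PUnit.{1} :=
  ⟨⟨g, h0, hinv⟩, fun _ _ => ⟨Set.univ, Filter.univ_mem, fun l _ _ => hg l⟩⟩

/-- Once positions are forgotten, each layer is a prism from the identity to itself; the result is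
again pulled back from `K` and independent of the apex. -/
theorem coneOff_of_fst (N : ℕ) (x : E) (g : List (K × PUnit.{1}) → ZMod 2) :
    coneOff N x (fun t : List (K × E) => g (t.map fun p => (p.1, PUnit.unit)))
      = fun l => (fun t => ∑ _j ∈ Finset.range N, prism id id g t)
          (l.map fun p => (p.1, PUnit.unit)) := by
  funext l
  simp only [coneOff, prism_comp, prism_map]
  rfl

/-- The integral over a sphere of a cochain pulled back from the group vanishes. -/
theorem sphereInt_of_fst (N : ℕ) (e : ℕ → E) (k : ℕ) (g : List (K × PUnit.{1}) → ZMod 2)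
    (l : List (K × PUnit.{1})) :
    sphereInt N e k (fun t => g (t.map fun p => (p.1, PUnit.unit))) l = 0 := by
  cases k with
  | zero =>
    simp only [sphereInt, atPoint, List.map_map]
    exact two_eq _
  | succ k =>
    -- The cones with opposite apexes contribute equally and cancel mod 2.
    simp only [sphereInt, coneOff_of_fst, two_eq]
    exact sphereInt_zero _ _ _ _

/-- The cone turns this into the integral of a pulled-back cochain over the equator. In dimension
`0` the hemisphere is a point and the integral is `g` itself, which is why the index is `k + 1`. -/
theorem hemiInt_of_fst (N : ℕ) (e : ℕ → E) (k : ℕ) (x : E) (g : List (K × PUnit.{1}) → ZMod 2)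
    (l : List (K × PUnit.{1})) :
    hemiInt N e (k + 1) x (fun t => g (t.map fun p => (p.1, PUnit.unit))) l = 0 := by
  rw [hemiInt, coneOff_of_fst]
  exact sphereInt_of_fst N e k (fun t => ∑ _j ∈ Finset.range N, prism id id g t) l

/-- Disposes of the apex term of `cobd_coneOff`: restricted to one point, a cochain depends on group
elements only. -/
theorem sphereInt_atPoint (N : ℕ) (e : ℕ → E) (k : ℕ) (x : E) (f : List (K × E) → ZMod 2)
    (l : List (K × PUnit.{1})) :
    sphereInt N e k (fun t => f (t.map fun p => (p.1, x))) l = 0 := by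
  rw [← sphereInt_of_fst N e k (atPoint x f) l]
  simp only [atPoint, List.map_map]
  rfl

/-- The sphere has no boundary: its two halves share the equator, whose contributions cancel. -/
theorem cobd_sphereInt {N : ℕ} (hN : N ≠ 0) (e : ℕ → E) (k : ℕ) (f : List (K × E) → ZMod 2)
    (l : List (K × PUnit.{1})) :
    cobd (sphereInt N e k f) l = sphereInt N e k (cobd f) l := by
  induction k generalizing f with
  | zero =>
    change cobd (fun l => atPoint (e 0) f l + atPoint (-e 0) f l) l = _
    rw [cobd_add]
    simp only [sphereInt, atPoint, cobd_map]
    rfl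
  | succ k ih =>
    change cobd (sphereInt N e k _) l = sphereInt N e k _ l
    rw [ih, show cobd (fun t => coneOff N (e (k + 1)) f t + coneOff N (-e (k + 1)) f t) = _ from
      funext fun t => by rw [cobd_add, cobd_coneOff hN, cobd_coneOff hN]]
    simp only [sphereInt_add, sphereInt_atPoint]
    linear_combination two_eq (sphereInt N e k f l)

theorem cobd_hemiInt_zero (N : ℕ) (e : ℕ → E) (x : E) (f : List (K × E) → ZMod 2)
    (l : List (K × PUnit.{1})) :
    cobd (hemiInt N e 0 x f) l = hemiInt N e 0 x (cobd f) l := by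
  simp only [hemiInt, atPoint, cobd_map]
  rfl

/-- Stokes' formula: the boundary of the hemisphere is the equator. -/
theorem cobd_hemiInt_succ {N : ℕ} (hN : N ≠ 0) (e : ℕ → E) (k : ℕ) (x : E)
    (f : List (K × E) → ZMod 2) (l : List (K × PUnit.{1})) :
    cobd (hemiInt N e (k + 1) x f) l
      = hemiInt N e (k + 1) x (cobd f) l + sphereInt N e k f l := by
  change cobd (sphereInt N e k _) l = sphereInt N e k _ l + _
  rw [cobd_sphereInt hN, show cobd (coneOff N x f) = _ from funext fun t => cobd_coneOff hN x f t]
  simp only [sphereInt_add, sphereInt_atPoint, add_zero]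

theorem coneOff_nil (N : ℕ) (x : E) (f : List (K × E) → ZMod 2) : coneOff N x f [] = 0 := by
  simp [coneOff]

theorem sphereInt_nil (N : ℕ) (e : ℕ → E) (k : ℕ) (f : List (K × E) → ZMod 2) (hf : f [] = 0) :
    sphereInt N e k f [] = 0 := by
  induction k generalizing f with
  | zero => simp [sphereInt, atPoint, hf]
  | succ k ih => exact ih _ (by simp [coneOff_nil])

theorem hemiInt_nil (N : ℕ) (e : ℕ → E) (k : ℕ) (x : E) (f : List (K × E) → ZMod 2)
    (hf : f [] = 0) : hemiInt N e k x f [] = 0 := by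
  cases k with
  | zero => simpa [hemiInt, atPoint] using hf
  | succ k => exact sphereInt_nil _ _ _ _ (coneOff_nil _ _ _)

/-- Each cone lowers the degree by one, so integration over the `k`-sphere lowers it by `k`. -/
theorem sphereInt_eq_zero_of_length (N : ℕ) (e : ℕ → E) (k m : ℕ) (f : List (K × E) → ZMod 2)
    (hf : ∀ l, l.length ≠ m → f l = 0) (l : List (K × PUnit.{1})) (hl : l.length + k ≠ m) :
    sphereInt N e k f l = 0 := by
  induction k generalizing f m with
  | zero =>
    simp only [sphereInt, atPoint]
    rw [hf _ (by simpa using hl), hf _ (by simpa using hl), add_zero]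
  | succ k ih =>
    rcases m with _ | m
    · have h : ∀ x, coneOff N x f = fun _ => 0 := fun x => funext fun t =>
        Finset.sum_eq_zero fun j _ => prism_eq_zero _ _ _ _ fun s _ hs => hf _ (by omega)
      simp only [sphereInt, h, add_zero]
      exact sphereInt_zero _ _ _ _
    · have h : ∀ x t, t.length ≠ m → coneOff N x f t = 0 := fun x t ht =>
        Finset.sum_eq_zero fun j _ => prism_eq_zero _ _ _ _ fun s _ hs => hf _ (by omega)
      exact ih m _ (fun t ht => by rw [h _ t ht, h _ t ht, add_zero]) (by omega)

/-! ### Equivariance of the integrals -/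

section Equivariance

variable (act : K → E →ₗ[ℝ] E)

/-- The diagonal action on pairs. -/
def shift (s : K) (p : K × E) : K × E := (s * p.1, act s p.2)

theorem coneOff_shift (N : ℕ) (x : E) (f : List (K × E) → ZMod 2) (s : K) (l : List (K × E)) :
    coneOff N x (fun t => f (t.map (shift act s))) l
      = coneOff N (act s x) f (l.map (shift act s)) := by
  simp only [coneOff, prism_comp, prism_map]
  have h : ∀ t : ℝ, shift act s ∘ slide x t = slide (act s x) t ∘ shift act s := fun t =>
    funext fun p => by simp [shift, slide]
  simp only [h]

theorem atPoint_shift (x : E) (f : List (K × E) → ZMod 2) (s : K) (l : List (K × PUnit.{1})) :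
    atPoint x (fun t => f (t.map (shift act s))) l
      = atPoint (act s x) f (l.map (s • ·)) := by
  simp only [atPoint, List.map_map]
  rfl

variable {act} {e : ℕ → E} {χ : ℕ → K →* ℤˣ}

theorem act_eq_or (hact : ∀ s k, act s (e k) = ((χ k s : ℤ) : ℝ) • e k) (s : K) (k : ℕ) :
    (χ k s = 1 ∧ act s (e k) = e k ∧ act s (-e k) = -e k) ∨
      (χ k s ≠ 1 ∧ act s (e k) = -e k ∧ act s (-e k) = e k) := by
  rcases Int.units_eq_one_or (χ k s) with h | h
  · refine Or.inl ⟨h, ?_, ?_⟩ <;> simp [hact, h]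
  · refine Or.inr ⟨by rw [h]; decide, ?_, ?_⟩ <;> simp [hact, h]

/-- The group sends each `e k` to `± e k`, hence permutes the two cones at every stage. -/
theorem sphereInt_shift (hact : ∀ s k, act s (e k) = ((χ k s : ℤ) : ℝ) • e k) (N k : ℕ)
    (f : List (K × E) → ZMod 2) (s : K) (l : List (K × PUnit.{1})) :
    sphereInt N e k (fun t => f (t.map (shift act s))) l
      = sphereInt N e k f (l.map (s • ·)) := by
  induction k generalizing f with
  | zero =>
    simp only [sphereInt, atPoint_shift]
    rcases act_eq_or hact s 0 with ⟨_, h1, h2⟩ | ⟨_, h1, h2⟩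
    · rw [h1, h2]
    · rw [h1, h2, add_comm]
  | succ k ih =>
    simp only [sphereInt, coneOff_shift]
    rw [← ih]
    rcases act_eq_or hact s (k + 1) with ⟨_, h1, h2⟩ | ⟨_, h1, h2⟩
    · rw [h1, h2]
    · rw [h1, h2]
      simp only [add_comm]

theorem hemiInt_shift (hact : ∀ s k, act s (e k) = ((χ k s : ℤ) : ℝ) • e k) (N k : ℕ) (x : E)
    (f : List (K × E) → ZMod 2) (s : K) (l : List (K × PUnit.{1})) :
    hemiInt N e k x (fun t => f (t.map (shift act s))) l
      = hemiInt N e k (act s x) f (l.map (s • ·)) := by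
  cases k with
  | zero => exact atPoint_shift _ _ _ _ _
  | succ k =>
    simp only [hemiInt]
    rw [← sphereInt_shift hact]
    exact congrArg (sphereInt N e k · l) (funext fun t => coneOff_shift act N x f s t)

/-- An element fixes the hemisphere or swaps it with the opposite one, and the two add up to the
sphere. This is the invariance hypothesis of `cls_eq_charClass_mul`, with the hemisphere integral as
`p` and the sphere integral as `R`. -/
theorem hemiInt_map_smul (hact : ∀ s k, act s (e k) = ((χ k s : ℤ) : ℝ) • e k) (N k : ℕ)
    (f : List (K × E) → ZMod 2) (hf : ∀ s l, f (l.map (shift act s)) = f l) (s : K)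
    (l : List (K × PUnit.{1})) :
    hemiInt N e k (e k) f (l.map (s • ·))
      = hemiInt N e k (e k) f l + if χ k s = 1 then 0 else sphereInt N e k f l := by
  have h := fun x => hemiInt_shift hact N k x f s l
  simp only [hf] at h
  rcases act_eq_or hact s k with ⟨h0, h1, h2⟩ | ⟨h0, h1, h2⟩
  · rw [if_pos h0, add_zero, h (e k), h1]
  · have h3 := h (-e k)
    rw [h2] at h3
    rw [if_neg h0, sphereInt_eq_add, ← h3]
    linear_combination (-1 : ZMod 2) * two_eq (hemiInt N e k (e k) f l)

end Equivariance

/-! ### Control of diameters on the unit sphere -/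

section Small

variable (coord : ℕ → E →ₗ[ℝ] ℝ) (d : ℕ)

/-- The vectors of the unit sphere of the `ℓ¹`-norm whose coordinates of index at least `k`
vanish. -/
def OnSphere (k : ℕ) (v : E) : Prop :=
  (∀ i, k ≤ i → coord i v = 0) ∧ ∑ i ∈ Finset.range d, |coord i v| = 1

/-- The cochain `f` vanishes on the lists of diameter at most `r` on the sphere. -/
def VanishesOnSmall (k : ℕ) (r : ℝ) (f : List (K × E) → ZMod 2) : Prop :=
  ∀ l : List (K × E), (∀ p ∈ l, OnSphere coord d k p.2) →
    (∀ p ∈ l, ∀ q ∈ l, ∀ i, |coord i p.2 - coord i q.2| ≤ r) → f l = 0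

variable {coord d}

theorem OnSphere.abs_le {k : ℕ} {v : E} (hk : k ≤ d) (h : OnSphere coord d k v) (i : ℕ) :
    |coord i v| ≤ 1 := by
  by_cases hi : i < d
  · rw [← h.2]
    exact Finset.single_le_sum (f := fun i => |coord i v|) (fun _ _ => abs_nonneg _)
      (Finset.mem_range.2 hi)
  · rw [h.1 i (by omega)]; simp

theorem VanishesOnSmall.mono {k k' : ℕ} {r r' : ℝ} {f : List (K × E) → ZMod 2}
    (h : VanishesOnSmall coord d k r f) (hk : k' ≤ k) (hr : r' ≤ r) :
    VanishesOnSmall coord d k' r' f := fun l hl hl' =>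
  h l (fun p hp => ⟨fun i hi => (hl p hp).1 i (hk.trans hi), (hl p hp).2⟩)
    fun p hp q hq i => (hl' p hp q hq i).trans hr

theorem VanishesOnSmall.add {k : ℕ} {r : ℝ} {f g : List (K × E) → ZMod 2}
    (hf : VanishesOnSmall coord d k r f) (hg : VanishesOnSmall coord d k r g) :
    VanishesOnSmall coord d k r (fun l => f l + g l) := fun l hl hl' => by
  change f l + g l = 0
  rw [hf l hl hl', hg l hl hl', add_zero]

/-- The reason for the `ℓ¹`-norm: `x` and `v` have disjoint sets of nonzero coordinates, so the norm
is affine on the segment and straight cones stay on the sphere. -/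
theorem OnSphere.slide {k : ℕ} {v x : E} (hv : OnSphere coord d k v)
    (hx : ∀ i, i ≠ k → coord i x = 0) (hx' : ∑ i ∈ Finset.range d, |coord i x| = 1) {t : ℝ}
    (ht : 0 ≤ t) (ht' : t ≤ 1) : OnSphere coord d (k + 1) ((1 - t) • x + t • v) := by
  refine ⟨fun i hi => by simp [hv.1 i (by omega), hx i (by omega)], ?_⟩
  have h : ∀ i, |coord i ((1 - t) • x + t • v)| = (1 - t) * |coord i x| + t * |coord i v| := by
    intro i
    by_cases hi : i = k
    · simp [hv.1 i hi.ge, abs_mul, abs_of_nonneg (sub_nonneg.2 ht')]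
    · simp [hx i hi, abs_mul, abs_of_nonneg ht]
  simp only [h]
  rw [Finset.sum_add_distrib, ← Finset.mul_sum, ← Finset.mul_sum, hx', hv.2]
  ring

/-- One layer of a cone increases diameters by at most its thickness `1 / N` times the bound `2` on
coordinate differences of points of the sphere. -/
theorem VanishesOnSmall.coneOff {N k : ℕ} {r : ℝ} {f : List (K × E) → ZMod 2} (hN : N ≠ 0)
    (hk : k < d) (h : VanishesOnSmall coord d (k + 1) (r + 2 / N) f) {x : E}
    (hx : OnSphere coord d (k + 1) x) (hx' : ∀ i, i ≠ k → coord i x = 0) :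
    VanishesOnSmall coord d k r (coneOff N x f) := by
  intro l hl hl'
  refine Finset.sum_eq_zero fun j hj => prism_eq_zero _ _ _ _ fun t ht _ => ?_
  have hN' : (0 : ℝ) < N := by positivity
  have hj' : ((j + 1 : ℕ) : ℝ) ≤ N := by exact_mod_cast Finset.mem_range.1 hj
  have key : ∀ p ∈ t, ∃ q ∈ l, ∃ s : ℝ, (j : ℝ) / N ≤ s ∧ s ≤ (j + 1 : ℕ) / N ∧
      p.2 = (1 - s) • x + s • q.2 := by
    intro p hp
    have hle : (j : ℝ) / N ≤ (j + 1 : ℕ) / N := by gcongr; simp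
    obtain ⟨q, hq, rfl | rfl⟩ := ht p hp
    · exact ⟨q, hq, _, le_rfl, hle, rfl⟩
    · exact ⟨q, hq, _, hle, le_rfl, rfl⟩
  have hs0 : ∀ s : ℝ, (j : ℝ) / N ≤ s → 0 ≤ s := fun s hs => le_trans (by positivity) hs
  have hs1 : ∀ s : ℝ, s ≤ (j + 1 : ℕ) / N → s ≤ 1 := fun s hs =>
    hs.trans ((div_le_one hN').2 hj')
  refine h t (fun p hp => ?_) fun p hp q hq i => ?_
  · obtain ⟨q, hq, s, h1, h2, hs⟩ := key p hp
    rw [hs]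
    exact (hl q hq).slide hx' hx.2 (hs0 s h1) (hs1 s h2)
  · obtain ⟨p', hp', s, h1, h2, hs⟩ := key p hp
    obtain ⟨q', hq', s', h1', h2', hs'⟩ := key q hq
    rw [hs, hs']
    have e1 : coord i ((1 - s) • x + s • p'.2) - coord i ((1 - s') • x + s' • q'.2)
        = s * (coord i p'.2 - coord i q'.2) + (s - s') * (coord i q'.2 - coord i x) := by
      simp; ring
    have e2 : |s * (coord i p'.2 - coord i q'.2)| ≤ r := by
      rw [abs_mul, abs_of_nonneg (hs0 s h1)]
      calc s * _ ≤ 1 * |coord i p'.2 - coord i q'.2| := by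
            gcongr; exact hs1 s h2
        _ ≤ r := by rw [one_mul]; exact hl' p' hp' q' hq' i
    have e3 : |s - s'| ≤ 1 / N := by
      have : ((j + 1 : ℕ) : ℝ) / N = j / N + 1 / N := by push_cast; ring
      rw [abs_le]; constructor <;> linarith
    have e4 : |coord i q'.2 - coord i x| ≤ 2 := by
      have a1 := (hl q' hq').abs_le hk.le i
      have a2 := hx.abs_le hk i
      have := abs_sub (coord i q'.2) (coord i x)
      linarith
    rw [e1]
    calc _ ≤ |s * (coord i p'.2 - coord i q'.2)| + |(s - s') * (coord i q'.2 - coord i x)| :=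
          abs_add_le _ _
      _ ≤ r + 1 / N * 2 := by
          rw [abs_mul (s - s')]
          gcongr
      _ = r + 2 / N := by ring

variable {e : ℕ → E}

theorem onSphere_basis (he : ∀ i j, j < d → coord i (e j) = if i = j then 1 else 0) {k : ℕ}
    (hk : k < d) : OnSphere coord d (k + 1) (e k) ∧ OnSphere coord d (k + 1) (-e k) := by
  refine ⟨⟨fun i hi => ?_, ?_⟩, ⟨fun i hi => ?_, ?_⟩⟩
  · rw [he i k hk, if_neg (by omega)]
  · rw [Finset.sum_eq_single_of_mem k (Finset.mem_range.2 hk)] <;> simp +contextual [he, hk]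
  · rw [map_neg, he i k hk, if_neg (by omega), neg_zero]
  · rw [Finset.sum_eq_single_of_mem k (Finset.mem_range.2 hk)] <;> simp +contextual [he, hk]

theorem atPoint_eq_zero_of_small {k : ℕ} {x : E} (hx : OnSphere coord d k x)
    {f : List (K × E) → ZMod 2} (h : VanishesOnSmall coord d k 0 f) (l : List (K × PUnit.{1})) :
    atPoint x f l = 0 := by
  have h' : ∀ p ∈ l.map fun p : K × PUnit.{1} => (p.1, x), p.2 = x := by
    intro p hp
    obtain ⟨q, -, rfl⟩ := List.mem_map.1 hp
    rfl
  exact h _ (fun p hp => (h' p hp).symm ▸ hx) fun p hp q hq i => by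
    rw [h' p hp, h' q hq, sub_self, abs_zero]

/-- A `k`-sphere is built with `k` successive cones, each costing `2 / N`; this explains the radius
`k * (2 / N)`. -/
theorem sphereInt_eq_zero_of_small (he : ∀ i j, j < d → coord i (e j) = if i = j then 1 else 0)
    {N : ℕ} (hN : N ≠ 0) {k : ℕ} (hk : k < d) (f : List (K × E) → ZMod 2)
    (h : VanishesOnSmall coord d (k + 1) (k * (2 / N)) f) (l : List (K × PUnit.{1})) :
    sphereInt N e k f l = 0 := by
  induction k generalizing f with
  | zero =>
    obtain ⟨h1, h2⟩ := onSphere_basis he hk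
    have h' : VanishesOnSmall coord d 1 0 f := h.mono le_rfl (by simp)
    rw [sphereInt, atPoint_eq_zero_of_small h1 h', atPoint_eq_zero_of_small h2 h', add_zero]
  | succ k ih =>
    obtain ⟨h1, h2⟩ := onSphere_basis he hk
    have h' : VanishesOnSmall coord d (k + 1 + 1) (k * (2 / N) + 2 / N) f :=
      h.mono le_rfl (by push_cast; linarith)
    refine ih (by omega) _ ((h'.coneOff hN hk h1 ?_).add (h'.coneOff hN hk h2 ?_))
    · exact fun i hi => by rw [he i _ hk, if_neg hi]
    · exact fun i hi => by rw [map_neg, he i _ hk, if_neg hi, neg_zero]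

theorem hemiInt_eq_zero_of_small (he : ∀ i j, j < d → coord i (e j) = if i = j then 1 else 0)
    {N : ℕ} (hN : N ≠ 0) {k : ℕ} (hk : k < d) (f : List (K × E) → ZMod 2)
    (h : VanishesOnSmall coord d (k + 1) (k * (2 / N)) f) (l : List (K × PUnit.{1})) :
    hemiInt N e k (e k) f l = 0 := by
  obtain ⟨h1, -⟩ := onSphere_basis he hk
  cases k with
  | zero => exact atPoint_eq_zero_of_small h1 (h.mono le_rfl (by simp)) l
  | succ k =>
    have h' : VanishesOnSmall coord d (k + 1 + 1) (k * (2 / N) + 2 / N) f :=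
      h.mono le_rfl (by push_cast; linarith)
    exact sphereInt_eq_zero_of_small he hN (by omega) _
      (h'.coneOff hN hk h1 fun i hi => by rw [he i _ hk, if_neg hi]) l

/-- If a class on `K` bounds on small lists of the unit sphere of a sum of `d` characters, then it is a
multiple of the product of the classes of the characters. -/
theorem cls_eq_prod_mul {act : K → E →ₗ[ℝ] E} {χ : ℕ → K →* ℤˣ}
    (hact : ∀ s k, act s (e k) = ((χ k s : ℤ) : ℝ) • e k)
    (he : ∀ i j, j < d + 1 → coord i (e j) = if i = j then 1 else 0)
    {N : ℕ} (hN : N ≠ 0) (α : cocycles K PUnit.{1}) (f : List (K × E) → ZMod 2)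
    (hf0 : f [] = 0) (hf : ∀ s l, f (l.map (shift act s)) = f l)
    (h : VanishesOnSmall coord (d + 1) (d + 1) (d * (2 / N))
      (fun l => α.1.1 (l.map fun p => (p.1, PUnit.unit)) + cobd f l)) :
    ∃ γ : cocycles K PUnit.{1}, γ.1.1 = sphereInt N e d f ∧
      cls α = (∏ i ∈ Finset.range (d + 1), charClass _ (χ i)) * cls γ := by
  -- The coboundary of `f` is split mod 2 into a part pulled back from the group, with vanishing
  -- integrals except over a single point, and a part that vanishes on small lists.
  have hcob : cobd f = fun l => α.1.1 (l.map fun p => (p.1, PUnit.unit))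
      + (α.1.1 (l.map fun p => (p.1, PUnit.unit)) + cobd f l) := funext fun l => by
    linear_combination (-1 : ZMod 2) * two_eq (α.1.1 (l.map fun p => (p.1, PUnit.unit)))
  have hmono : ∀ k < d + 1, VanishesOnSmall coord (d + 1) (k + 1) (k * (2 / N))
      (fun l => α.1.1 (l.map fun p => (p.1, PUnit.unit)) + cobd f l) := fun k hk =>
    h.mono hk (by have : k ≤ d := by omega
                  gcongr)
  have hsphere : ∀ k < d + 1, ∀ l, sphereInt N e k (cobd f) l = 0 := fun k hk l => by
    rw [hcob, sphereInt_add, sphereInt_of_fst,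
      sphereInt_eq_zero_of_small he hN hk _ (hmono k hk), add_zero]
  have hhemi : ∀ k, k + 1 < d + 1 → ∀ l, hemiInt N e (k + 1) (e (k + 1)) (cobd f) l = 0 :=
    fun k hk l => by
      rw [hcob, hemiInt_add, hemiInt_eq_zero_of_small he hN hk _ (hmono _ hk), add_zero]
      exact hemiInt_of_fst _ _ _ _ _ _
  let Z : ∀ k, k < d + 1 → cocycles K PUnit.{1} := fun k hk =>
    pointCocycle (sphereInt N e k f) (sphereInt_nil _ _ _ _ hf0)
      (fun s l => by rw [← sphereInt_shift hact]; simp only [hf])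
      fun l => (cobd_sphereInt hN _ _ _ _).trans (hsphere k hk l)
  -- The integral over the hemisphere with apex `e (k + 1)` has coboundary `Z k`, and fails to be
  -- invariant by `Z (k + 1)`.
  have step : ∀ k (hk : k + 1 < d + 1),
      cls (Z k (by omega)) = charClass _ (χ (k + 1)) * cls (Z (k + 1) hk) := fun k hk =>
    cls_eq_charClass_mul (χ (k + 1)) (hemiInt N e (k + 1) (e (k + 1)) f)
      (hemiInt_nil _ _ _ _ _ hf0) _ _ (fun s l => hemiInt_map_smul hact _ _ _ hf s l)
      fun l => by rw [cobd_hemiInt_succ hN, hhemi k hk, zero_add]; rfl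
  -- Here the hemisphere is the point `e 0`, at which the coboundary of `f` restricts to `α`.
  have start : cls α = charClass _ (χ 0) * cls (Z 0 (by omega)) := by
    refine cls_eq_charClass_mul (χ 0) (hemiInt N e 0 (e 0) f)
      (hemiInt_nil _ _ _ _ _ hf0) _ _ (fun s l => hemiInt_map_smul hact _ _ _ hf s l)
      fun l => ?_
    rw [cobd_hemiInt_zero, hcob, hemiInt_add,
      hemiInt_eq_zero_of_small he hN (by omega) _ (hmono 0 (by omega)), add_zero]
    simp only [hemiInt, atPoint, List.map_map]
    exact congrArg α.1.1 ((List.map_congr_left fun p _ => rfl).trans (List.map_id l))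
  have all : ∀ k (hk : k < d + 1),
      cls α = (∏ i ∈ Finset.range (k + 1), charClass _ (χ i)) * cls (Z k hk) := by
    intro k
    induction k with
    | zero => intro hk; simpa using start
    | succ k ih =>
      intro hk
      rw [ih (by omega), step k hk, Finset.prod_range_succ _ (k + 1), mul_assoc]
  exact ⟨Z d (by omega), rfl, all d (by omega)⟩

end Small

end Integration

end EquivariantCohomology

/-! ### The kernel of the pullback to `V ∖ {0}` in degree `dim V` -/

namespace StiefelWhitney

open EquivariantCohomology ListCochain

variable {G : Type*} [Group G] {V : Type*} [AddCommGroup V] [Module ℝ V]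

/-- The pullback `H^*(G × {±1}) → H^*_{G × {±1}}(V ∖ {0})`. -/
noncomputable def fromPoint (ρ : Representation ℝ G V) :
    CohomologyRing (G × ℤˣ) →+* BorelCohomology (G × ℤˣ) (Punctured ρ) :=
  pullback (MonoidHom.id _) (fun _ => PUnit.unit) continuous_const fun _ _ => rfl

theorem fromPoint_inflate (ρ : Representation ℝ G V) (a : CohomologyRing G) :
    fromPoint ρ (inflate a) = fromBase ρ a := by
  obtain ⟨z, rfl⟩ := cls_surjective a
  refine congrArg cls (Subtype.ext (Subtype.ext (funext fun l => ?_)))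
  change z.1.1 (List.map _ (List.map _ l)) = z.1.1 (List.map _ l)
  rw [List.map_map]
  rfl

theorem tautClass_eq_charClass (ρ : Representation ℝ G V) :
    tautClass ρ = charClass _ (MonoidHom.snd G ℤˣ) := by
  refine congrArg cls (Subtype.ext (Subtype.ext (funext fun l => ?_)))
  change tautCochain ρ l = charFun _ l
  rcases l with _ | ⟨p, _ | ⟨q, _ | ⟨r, l⟩⟩⟩ <;> rfl

theorem fromPoint_charClass (ρ : Representation ℝ G V) (χ : G × ℤˣ →* ℤˣ) :
    fromPoint ρ (charClass _ χ) = charClass _ χ := pullback_charClass _ _ _ _ _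

/-- The action of `G × {±1}` on `V`. -/
def signedAct (ρ : Representation ℝ G V) (s : G × ℤˣ) : V →ₗ[ℝ] V := ((s.2 : ℤ) : ℝ) • ρ s.1

variable {ρ : Representation ℝ G V}

/-- The underlying vectors of a list of nonzero vectors. -/
def toVector (p : (G × ℤˣ) × Punctured ρ) : (G × ℤˣ) × V := (p.1, p.2.1)

theorem toVector_injective : Function.Injective (toVector (ρ := ρ)) := by
  rintro ⟨k, v⟩ ⟨k', v'⟩ h
  obtain ⟨h1, h2⟩ := Prod.mk.inj h
  exact Prod.ext h1 (Subtype.ext h2)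

/-- Extension by zero of a function of lists of nonzero vectors. -/
noncomputable def extendByZero (h : List ((G × ℤˣ) × Punctured ρ) → ZMod 2) :
    List ((G × ℤˣ) × V) → ZMod 2 := Function.extend (List.map toVector) h 0

theorem extendByZero_map (h : List ((G × ℤˣ) × Punctured ρ) → ZMod 2)
    (l : List ((G × ℤˣ) × Punctured ρ)) : extendByZero h (l.map toVector) = h l :=
  (List.map_injective_iff.2 toVector_injective).extend_apply _ _ _

theorem extendByZero_shift (h : List ((G × ℤˣ) × Punctured ρ) → ZMod 2)
    (hh : ∀ (s : G × ℤˣ) l, h (l.map (s • ·)) = h l) (s : G × ℤˣ) (l : List ((G × ℤˣ) × V)) :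
    extendByZero h (l.map (shift (signedAct ρ) s)) = extendByZero h l := by
  have key : ∀ (s : G × ℤˣ) (t : List ((G × ℤˣ) × Punctured ρ)),
      (t.map toVector).map (shift (signedAct ρ) s) = (t.map (s • ·)).map toVector := by
    intro s t
    rw [List.map_map, List.map_map]
    rfl
  by_cases hl : ∃ t, List.map (toVector (ρ := ρ)) t = l
  · obtain ⟨t, rfl⟩ := hl
    rw [key, extendByZero_map, extendByZero_map, hh]
  · rw [extendByZero, Function.extend_apply' _ _ _ hl, Function.extend_apply']
    · rfl
    rintro ⟨t, ht⟩
    refine hl ⟨t.map (s⁻¹ • ·), ?_⟩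
    rw [← key, ht, List.map_map]
    convert List.map_id l
    funext p
    refine Prod.ext (by simp [shift]) ?_
    have h1 : ((s.2 : ℤ) : ℝ) * ((s.2 : ℤ) : ℝ) = 1 := by
      rcases Int.units_eq_one_or s.2 with h | h <;> simp [h]
    have h2 : ρ s.1⁻¹ (ρ s.1 p.2) = p.2 := by
      rw [← Module.End.mul_apply, ← map_mul, inv_mul_cancel, map_one]; rfl
    simp [shift, signedAct, smul_smul, h1, h2]

/-- Small lists of vectors on the unit sphere, in the coordinates of a basis, are small for a
locally zero function. -/
theorem exists_small [Finite G] {D : ℕ} (b : Module.Basis (Fin D) ℝ V) (m : ℕ)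
    (f : List ((G × ℤˣ) × Punctured ρ) → ZMod 2) (hf : LocallyZero f) :
    ∃ ε > 0, ∀ l : List ((G × ℤˣ) × Punctured ρ), l.length = m →
      (∀ p ∈ l, ∑ i, |b.equivFun p.2.1 i| = 1) →
      (∀ p ∈ l, ∀ q ∈ l, ∀ i, |b.equivFun p.2.1 i - b.equivFun q.2.1 i| ≤ ε) → l ≠ [] → f l = 0 := by
  let S : Set (Fin D → ℝ) := {y | ∑ i, |y i| = 1}
  have hS : IsCompact S := by
    refine Metric.isCompact_of_isClosed_isBounded (isClosed_eq (by fun_prop) (by fun_prop)) ?_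
    refine (Metric.isBounded_closedBall (x := (0 : Fin D → ℝ)) (r := 1)).subset fun y hy => ?_
    rw [mem_closedBall_zero_iff, pi_norm_le_iff_of_nonneg zero_le_one]
    intro i
    rw [Real.norm_eq_abs, ← show ∑ i, |y i| = 1 from hy]
    exact Finset.single_le_sum (f := fun i => |y i|) (fun _ _ => abs_nonneg _) (Finset.mem_univ i)
  have key : ∀ y : S, ∃ O : Set (Fin D → ℝ), IsOpen O ∧ y.1 ∈ O ∧
      ∀ l : List ((G × ℤˣ) × Punctured ρ), l.length = m → (∀ p ∈ l, b.equivFun p.2.1 ∈ O) →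
        f l = 0 := by
    rintro ⟨y, hy⟩
    have hy0 : b.equivFun.symm y ≠ 0 := by
      intro h
      have hy' : ∑ i, |y i| = 1 := hy
      have : y = 0 := (LinearEquiv.map_eq_zero_iff _).1 h
      simp [this] at hy'
    let x : Punctured ρ := ⟨b.equivFun.symm y, hy0⟩
    choose U hU hfU using fun ks => hf ks x
    -- Local vanishing gives a neighbourhood for each list of group elements. Finiteness of `G`
    -- leaves finitely many lists of length `m`, so one neighbourhood serves all.
    let A : Set (List (G × ℤˣ)) := {ks | ks.length = m}
    have hA : A.Finite := List.finite_length_eq _ _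
    have hU' : (⋂ ks ∈ A, U ks) ∈ nhds x := (Filter.biInter_mem hA).2 fun ks _ => hU ks
    let _ : TopologicalSpace V := moduleTopology ℝ V
    have : IsModuleTopology ℝ V := ⟨rfl⟩
    have : ContinuousAdd V := IsModuleTopology.toContinuousAdd ℝ V
    obtain ⟨W, hW, hWU⟩ := mem_nhds_induced (fun v : Punctured ρ => v.1) x _ |>.1 hU'
    have hc : Continuous b.equivFun.symm :=
      IsModuleTopology.continuous_of_linearMap b.equivFun.symm.toLinearMap
    have hO : b.equivFun.symm ⁻¹' W ∈ nhds y := hc.continuousAt hW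
    obtain ⟨O, hOW, hO, hyO⟩ := mem_nhds_iff.1 hO
    refine ⟨O, hO, hyO, fun l hl hlO => ?_⟩
    refine hfU (l.map Prod.fst) l rfl fun p hp => ?_
    have h1 : b.equivFun.symm (b.equivFun p.2.1) ∈ W := hOW (hlO p hp)
    rw [LinearEquiv.symm_apply_apply] at h1
    have h2 := hWU h1
    simp only [Set.mem_iInter] at h2
    exact h2 _ (by simpa [A] using hl)
  choose O hO hyO hOf using key
  obtain ⟨δ, hδ, hball⟩ := lebesgue_number_lemma_of_metric hS hO
    fun y hy => Set.mem_iUnion.2 ⟨⟨y, hy⟩, hyO ⟨y, hy⟩⟩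
  -- Half the Lebesgue number: the bound is `≤`, while the ball is open.
  refine ⟨δ / 2, by positivity, fun l hl hlS hlε hne => ?_⟩
  obtain ⟨p0, hp0⟩ := List.exists_mem_of_ne_nil l hne
  obtain ⟨i, hi⟩ := hball _ (hlS p0 hp0)
  refine hOf i l hl fun p hp => hi ?_
  rw [Metric.mem_ball]
  refine lt_of_le_of_lt ((dist_pi_le_iff (by positivity)).2 fun j => ?_) (half_lt_self hδ)
  rw [Real.dist_eq]
  exact hlε p hp p0 hp0 j

/-- The character of `G × {±1}` on a line on which `G` acts by `ψ`. -/
def signedChar (ψ : G →* ℤˣ) : G × ℤˣ →* ℤˣ := ψ.comp (MonoidHom.fst G ℤˣ) * MonoidHom.snd G ℤˣ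

/-- In degree `dim V`, the kernel of `H^*(G × {±1}) → H^*_{G × {±1}}(V ∖ {0})` is generated by the
Euler class. -/
theorem eq_zero_or_eq_prod_of_fromPoint_eq_zero [Finite G] {d : ℕ} (b : Module.Basis (Fin (d + 1)) ℝ V)
    (ψ : Fin (d + 1) → G →* ℤˣ) (hb : ∀ g i, ρ g (b i) = ((ψ i g : ℤ) : ℝ) • b i)
    (a : CohomologyRing (G × ℤˣ)) (ha : IsHomogeneous (d + 1) a) (h0 : fromPoint ρ a = 0) :
    a = 0 ∨ a = ∏ i, charClass _ (signedChar (ψ i)) := by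
  obtain ⟨z, rfl, hz⟩ := ha
  obtain ⟨h, hh⟩ := (cls_eq_iff _ 0).1 (h0.trans (map_zero cls).symm)
  -- Only the component of degree `d` of the bounding cochain matters. With it the error `D` sits in
  -- the single degree `d + 1`, so that `exists_small`, which treats one length of lists, applies.
  set h1 : List ((G × ℤˣ) × Punctured ρ) → ZMod 2 := component d h.1 with hh1
  let D : List ((G × ℤˣ) × Punctured ρ) → ZMod 2 :=
    fun l => z.1.1 (l.map fun p => (p.1, PUnit.unit)) + cobd h1 l
  have hD : ∀ l, D l ≠ 0 → l.length = d + 2 := by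
    intro l hl
    by_contra hne
    refine hl ?_
    simp only [D, hh1]
    rw [hz _ (by simpa using hne), cobd_component, component, if_neg hne, add_zero]
  have hD0 : LocallyZero D := by
    refine LocallyZero.of_sublist hh fun l hl => ?_
    by_contra hne
    refine hne ?_
    have h2 := hl l (List.Sublist.refl l)
    change z.1.1 (l.map fun p => (p.1, PUnit.unit)) - 0 - cobd h.1 l = 0 at h2
    simp only [D, hh1]
    rw [cobd_component, component, if_pos (hD l hne)]
    linear_combination h2 + two_eq (cobd h.1 l)
  obtain ⟨ε, hε, hsmall⟩ := exists_small b (d + 2) D hD0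
  -- Enough layers for the total growth `d * (2 / N)` of diameters to stay below `ε`.
  obtain ⟨N, hN⟩ := exists_nat_gt (d * 2 / ε)
  have hNpos : (0 : ℝ) < N := lt_of_le_of_lt (by positivity) hN
  have hN0 : N ≠ 0 := by rintro rfl; simp at hNpos
  have hNε : d * (2 / (N : ℝ)) ≤ ε := by
    rw [div_lt_iff₀ hε] at hN
    rw [← mul_div_assoc, div_le_iff₀ hNpos]
    linarith
  let coord : ℕ → V →ₗ[ℝ] ℝ := fun i => if h : i < d + 1 then b.coord ⟨i, h⟩ else 0
  let e : ℕ → V := fun i => if h : i < d + 1 then b ⟨i, h⟩ else 0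
  let χ : ℕ → G × ℤˣ →* ℤˣ := fun i => if h : i < d + 1 then signedChar (ψ ⟨i, h⟩) else 1
  have hc : ∀ i (h : i < d + 1), coord i = b.coord ⟨i, h⟩ := fun i h => dif_pos h
  have hc0 : ∀ i, ¬i < d + 1 → coord i = 0 := fun i h => dif_neg h
  have he1 : ∀ i (h : i < d + 1), e i = b ⟨i, h⟩ := fun i h => dif_pos h
  have he0 : ∀ i, ¬i < d + 1 → e i = 0 := fun i h => dif_neg h
  have hχ : ∀ i (h : i < d + 1), χ i = signedChar (ψ ⟨i, h⟩) := fun i h => dif_pos h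
  have hcoord : ∀ i : Fin (d + 1), ∀ v, coord i v = b.equivFun v i := fun i v => by
    rw [hc _ i.2]
    simp
  have hact : ∀ s k, signedAct ρ s (e k) = ((χ k s : ℤ) : ℝ) • e k := by
    intro s k
    by_cases hk : k < d + 1
    · rw [he1 k hk, hχ k hk]
      simp [signedAct, signedChar, hb, smul_smul, mul_comm]
    · simp [he0 k hk]
  have he : ∀ i j, j < d + 1 → coord i (e j) = if i = j then 1 else 0 := by
    intro i j hj
    by_cases hi : i < d + 1
    · rw [hc i hi, he1 j hj]
      simp [Finsupp.single_apply, eq_comm]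
    · rw [if_neg (by omega), hc0 i hi]
      rfl
  obtain ⟨γ, hγ, hαγ⟩ := cls_eq_prod_mul hact he hN0 z (extendByZero h1)
    (by
      have := extendByZero_map h1 []
      rw [List.map_nil] at this
      rw [this, hh1, component, if_neg (by simp)])
    (extendByZero_shift h1 fun s l => by
      rw [hh1, component, component, h.2.2, List.length_map])
    (by
      intro l hlS hlε
      have hne : ∀ p ∈ l, p.2 ≠ 0 := by
        intro p hp h0
        have := (hlS p hp).2
        simp [h0] at this
      obtain ⟨t, rfl⟩ : ∃ t, List.map (toVector (ρ := ρ)) t = l :=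
        ⟨l.pmap (fun p hp => (p.1, ⟨p.2, hp⟩)) hne, by
          rw [List.map_pmap]
          exact (List.pmap_eq_map (f := id) hne).trans (List.map_id l)⟩
      change z.1.1 _ + cobd _ _ = 0
      rw [cobd_map, List.map_map]
      simp only [extendByZero_map]
      change D t = 0
      by_contra hDt
      refine hDt (hsmall t (hD t hDt) (fun p hp => ?_) (fun p hp q hq i => ?_) ?_)
      · have := (hlS _ (List.mem_map_of_mem hp)).2
        rw [Finset.sum_range] at this
        simp only [hcoord] at this
        exact this
      · have := hlε _ (List.mem_map_of_mem hp) _ (List.mem_map_of_mem hq) i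
        rw [hcoord, hcoord] at this
        exact this.trans hNε
      · rintro rfl
        simpa using hD [] hDt)
  have hprod : ∏ i ∈ Finset.range (d + 1), charClass PUnit.{1} (χ i)
      = ∏ i, charClass PUnit.{1} (signedChar (ψ i)) := by
    rw [Finset.prod_range]
    exact Finset.prod_congr rfl fun i _ => by rw [hχ i i.2]
  rw [hprod] at hαγ
  -- The bounding cochain has degree `d` and the sphere has dimension `d`, so `γ` has degree `0`; by
  -- invariance it is then a constant.
  have hγ0 : ∀ l, l.length ≠ 1 → γ.1.1 l = 0 := fun l hl => by
    rw [hγ]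
    refine sphereInt_eq_zero_of_length N e d (d + 1) _ (fun t ht => ?_) l (by omega)
    by_cases h' : ∃ s, List.map (toVector (ρ := ρ)) s = t
    · obtain ⟨s, rfl⟩ := h'
      rw [extendByZero_map, hh1, component, if_neg (by simpa using ht)]
    · rw [extendByZero, Function.extend_apply' _ _ _ h']; rfl
  have hγ1 : ∀ p, γ.1.1 [p] = γ.1.1 [(1, PUnit.unit)] := fun p => by
    rw [← γ.1.2.2 p.1 [(1, PUnit.unit)]]
    simp
  have h01 : ∀ c : ZMod 2, c = 0 ∨ c = 1 := by decide
  rcases h01 (γ.1.1 [(1, PUnit.unit)]) with hc | hc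
  · left
    have : γ = 0 := Subtype.ext (Subtype.ext (funext fun l => by
      rcases l with _ | ⟨p, _ | ⟨q, l⟩⟩
      · exact hγ0 _ (by simp)
      · exact (hγ1 p).trans hc
      · exact hγ0 _ (by simp)))
    rw [hαγ, this, map_zero, mul_zero]
  · right
    have : γ = 1 := Subtype.ext (Subtype.ext (funext fun l => by
      rcases l with _ | ⟨p, _ | ⟨q, l⟩⟩
      · exact hγ0 _ (by simp)
      · exact (hγ1 p).trans hc
      · exact hγ0 _ (by simp)))
    rw [hαγ, this, map_one, mul_one]

end StiefelWhitney

namespace EquivariantCohomology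

open ListCochain

/-! ### Products of locally vanishing classes -/

section NearPoint

variable {K X : Type*} [Group K] [TopologicalSpace X] [MulAction K X]

/-- The cochain `f` vanishes on the lists of points near `y`. -/
def VanishesNear (y : X) (f : List (K × X) → ZMod 2) : Prop :=
  ∃ U ∈ nhds y, ∀ l : List (K × X), (∀ p ∈ l, p.2 ∈ U) → f l = 0

theorem vanishesNear_list_prod (y : X) (L : List (cocycles K X))
    (hL : ∃ z ∈ L, VanishesNear y z.1.1) : VanishesNear y L.prod.1.1 := by
  induction L with
  | nil => simp at hL
  | cons z L ih =>
    rw [List.prod_cons]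
    obtain ⟨z', hz', h⟩ := hL
    rcases List.mem_cons.1 hz' with rfl | hz'
    · obtain ⟨U, hU, h⟩ := h
      exact ⟨U, hU, fun l hl => cup_eq_zero_left _ _ _ fun t ht =>
        h t fun p hp => hl p (ht.subset hp)⟩
    · obtain ⟨U, hU, h⟩ := ih ⟨z', hz', h⟩
      exact ⟨U, hU, fun l hl => cup_eq_zero_right _ _ _ fun t ht =>
        h t fun p hp => hl p (ht.subset hp)⟩

/-- A product of classes vanishes if every point has a neighbourhood on which one of the factors
vanishes. -/
theorem prod_cls_eq_zero {d : ℕ} (z : Fin d → cocycles K X)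
    (h : ∀ y : X, ∃ i, VanishesNear y (z i).1.1) : ∏ i, cls (z i) = 0 := by
  -- The product is taken over a list because cocycles commute only up to coboundaries.
  rw [← List.prod_ofFn, ← Function.comp_def, ← List.map_ofFn, ← map_list_prod, ← map_zero cls,
    cls_eq_iff]
  refine ⟨0, fun ks y => ?_⟩
  obtain ⟨i, hi⟩ := h y
  obtain ⟨U, hU, h⟩ := vanishesNear_list_prod y (List.ofFn z) ⟨z i, by simp, hi⟩
  refine ⟨U, hU, fun l _ hl => ?_⟩
  change (List.ofFn z).prod.1.1 l - 0 - cobd (fun _ => 0) l = 0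
  rw [h l hl, cobd_eq_zero _ _ fun _ _ => rfl, sub_zero, sub_zero]

end NearPoint

end EquivariantCohomology

/-! ### Vanishing of the Euler class on `V ∖ {0}` -/

namespace StiefelWhitney

open EquivariantCohomology ListCochain Polynomial

variable {G : Type*} [Group G] {V : Type*} [AddCommGroup V] [Module ℝ V]
  {ρ : Representation ℝ G V}

theorem continuous_coord (c : V →ₗ[ℝ] ℝ) : Continuous fun v : Punctured ρ => c v.1 := by
  let _ : TopologicalSpace V := moduleTopology ℝ V
  have : IsModuleTopology ℝ V := ⟨rfl⟩
  exact (IsModuleTopology.continuous_of_linearMap c).comp continuous_induced_dom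

open Classical in
/-- The function `(k, v) ↦ [χ k * c v ≤ 0]` in degree `0`. -/
noncomputable def signFun (χ : G × ℤˣ →* ℤˣ) (c : V →ₗ[ℝ] ℝ) :
    List ((G × ℤˣ) × Punctured ρ) → ZMod 2
  | [p] => if 0 < ((χ p.1 : ℤ) : ℝ) * c p.2.1 then 0 else 1
  | _ => 0

/-- While `c` keeps one sign, `signFun χ c` agrees in degree `0` with `indicator χ` up to an
additive constant, so it has the same coboundary. -/
theorem charFun_add_cobd_signFun (χ : G × ℤˣ →* ℤˣ) (c : V →ₗ[ℝ] ℝ)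
    (l : List ((G × ℤˣ) × Punctured ρ))
    (hl : (∀ p ∈ l, 0 < c p.2.1) ∨ ∀ p ∈ l, c p.2.1 < 0) :
    charFun χ l + cobd (signFun χ c) l = 0 := by
  rcases l with _ | ⟨p, _ | ⟨q, _ | ⟨r, l⟩⟩⟩
  · simp [charFun]
  · simp [charFun, signFun]
  · have pos : ∀ p : (G × ℤˣ) × Punctured ρ, 0 < c p.2.1 →
        signFun χ c [p] = if χ p.1 = 1 then 0 else 1 := by
      intro p hp
      rcases Int.units_eq_one_or (χ p.1) with h | h <;> simp [signFun, h, hp, hp.le]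
    have neg : ∀ p : (G × ℤˣ) × Punctured ρ, c p.2.1 < 0 →
        signFun χ c [p] = if χ p.1 = 1 then 1 else 0 := by
      intro p hp
      rcases Int.units_eq_one_or (χ p.1) with h | h <;> simp [signFun, h, hp, hp.le]
    simp only [cobd_cons, cobd_nil, charFun, add_zero]
    rcases hl with hl | hl
    · rw [pos p (hl p (by simp)), pos q (hl q (by simp))]
      have key : ∀ a b : ℤˣ, (if a = b then (0 : ZMod 2) else 1)
          + ((if b = 1 then 0 else 1) + if a = 1 then 0 else 1) = 0 := by decide
      exact key _ _
    · rw [neg p (hl p (by simp)), neg q (hl q (by simp))]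
      have key : ∀ a b : ℤˣ, (if a = b then (0 : ZMod 2) else 1)
          + ((if b = 1 then 1 else 0) + if a = 1 then 1 else 0) = 0 := by decide
      exact key _ _
  · have : cobd (signFun χ c) (p :: q :: r :: l) = 0 := by
      refine Finset.sum_eq_zero fun i hi => ?_
      have h := Finset.mem_range.1 hi
      have h' : ((p :: q :: r :: l).eraseIdx i).length = l.length + 2 := by
        rw [List.length_eraseIdx_of_lt h]; simp
      revert h'
      generalize (p :: q :: r :: l).eraseIdx i = t
      rcases t with _ | ⟨p', _ | ⟨q', t⟩⟩ <;> simp [signFun]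
    rw [this]
    simp [charFun]

/-- The Euler class of a sum of characters of `G × {±1}` vanishes on the complement of `0`. -/
theorem prod_charClass_eq_zero {d : ℕ} (b : Module.Basis (Fin d) ℝ V) (ψ : Fin d → G →* ℤˣ)
    (hb : ∀ g i, ρ g (b i) = ((ψ i g : ℤ) : ℝ) • b i) :
    ∏ i, charClass (Punctured ρ) (signedChar (ψ i)) = 0 := by
  -- The `i`-th coordinate transforms by the character `signedChar (ψ i)`, so the sign cochain is
  -- invariant.
  have hact : ∀ (s : G × ℤˣ) (v : Punctured ρ) i,
      b.coord i (s • v).1 = ((signedChar (ψ i) s : ℤ) : ℝ) * b.coord i v.1 := by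
    intro s v i
    have h : (b.coord i).comp (signedAct ρ s) = ((signedChar (ψ i) s : ℤ) : ℝ) • b.coord i := by
      refine b.ext fun j => ?_
      by_cases hij : j = i
      · subst hij
        simp [signedAct, signedChar, hb, mul_comm]
      · simp [signedAct, hb, hij]
    exact LinearMap.congr_fun h v.1
  let s : Fin d → cochains (G × ℤˣ) (Punctured ρ) := fun i =>
    ⟨signFun (signedChar (ψ i)) (b.coord i), rfl, fun k l => by
      rcases l with _ | ⟨p, _ | ⟨q, l⟩⟩
      · rfl
      · simp only [List.map_cons, List.map_nil, signFun, Prod.smul_fst, Prod.smul_snd, hact,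
          smul_eq_mul, map_mul, Units.val_mul, Int.cast_mul]
        have h : ((signedChar (ψ i) k : ℤ) : ℝ) * ((signedChar (ψ i) k : ℤ) : ℝ) = 1 := by
          rcases Int.units_eq_one_or (signedChar (ψ i) k) with h | h <;> simp [h]
        rw [mul_mul_mul_comm, h, one_mul]
      · rfl⟩
  -- A representative of the `i`-th factor that vanishes near every point whose `i`-th coordinate is
  -- nonzero.
  let z : Fin d → cocycles (G × ℤˣ) (Punctured ρ) := fun i =>
    ⟨(charCocycle _ (signedChar (ψ i))).1 + delta (s i), by
      change delta _ ∈ locallyZero _ _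
      rw [delta_add, delta_delta, add_zero]
      exact (charCocycle _ (signedChar (ψ i))).2⟩
  have hz : ∀ i, charClass _ (signedChar (ψ i)) = cls (z i) := fun i => by
    refine Eq.symm ((cls_eq_iff _ _).2 ⟨s i, ?_⟩)
    rw [add_sub_cancel_left, sub_self]
    exact zero_mem _
  simp only [hz]
  refine prod_cls_eq_zero z fun y => ?_
  obtain ⟨i, hi⟩ : ∃ i, b.coord i y.1 ≠ 0 := by
    by_contra! h
    exact y.2 (b.forall_coord_eq_zero_iff.1 h)
  refine ⟨i, ?_⟩
  have hc := continuous_coord (ρ := ρ) (b.coord i)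
  rcases lt_or_gt_of_ne hi with h | h
  · exact ⟨_, (isOpen_lt hc continuous_const).mem_nhds h,
      fun l hl => charFun_add_cobd_signFun _ _ l (Or.inr hl)⟩
  · exact ⟨_, (isOpen_lt continuous_const hc).mem_nhds h,
      fun l hl => charFun_add_cobd_signFun _ _ l (Or.inl hl)⟩

/-! ### Existence and uniqueness of the classes of a sum of characters -/

theorem charClass_signedChar (ψ : G →* ℤˣ) : charClass PUnit.{1} (signedChar ψ)
    = charClass PUnit.{1} (MonoidHom.snd G ℤˣ) + inflate (charClass PUnit.{1} ψ) := by
  rw [signedChar, charClass_mul, inflate, pullback_charClass, add_comm]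

/-- The polynomial `∏ᵢ (X + ψᵢ)` whose coefficients are the Stiefel–Whitney classes of a sum of
characters. -/
noncomputable def swPolynomial {d : ℕ} (ψ : Fin d → G →* ℤˣ) : (CohomologyRing G)[X] :=
  ∏ i, (X + C (charClass PUnit.{1} (ψ i)))

theorem eval₂_swPolynomial {d : ℕ} (ψ : Fin d → G →* ℤˣ) :
    (swPolynomial ψ).eval₂ inflate (charClass PUnit.{1} (MonoidHom.snd G ℤˣ))
      = ∏ i, charClass PUnit.{1} (signedChar (ψ i)) := by
  simp [swPolynomial, eval₂_finsetProd, charClass_signedChar]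

theorem natDegree_swPolynomial_le {d : ℕ} (ψ : Fin d → G →* ℤˣ) :
    (swPolynomial ψ).natDegree ≤ d := by
  refine (natDegree_prod_le _ _).trans ?_
  refine (Finset.sum_le_card_nsmul _ _ 1 fun i _ => ?_).trans (by simp)
  exact natDegree_add_le_of_degree_le natDegree_X_le (by simp)

theorem coeff_swPolynomial_self {d : ℕ} (ψ : Fin d → G →* ℤˣ) :
    (swPolynomial ψ).coeff d = 1 := by
  have h := Finset.prod_X_add_C_coeff Finset.univ (fun i => charClass PUnit.{1} (ψ i))
    (k := d) (by simp)
  rw [swPolynomial, h]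
  simp

theorem isHomogeneous_coeff {d : ℕ} (ψ : Fin d → G →* ℤˣ) {k : ℕ} (hk : k ≤ d) :
    IsHomogeneous k ((swPolynomial ψ).coeff (d - k)) := by
  have h := Finset.prod_X_add_C_coeff Finset.univ (fun i => charClass PUnit.{1} (ψ i))
    (k := d - k) (by simp)
  rw [swPolynomial, h]
  refine IsHomogeneous.sum _ fun t ht => ?_
  have ht' := (Finset.mem_powersetCard.1 ht).2
  rw [Finset.card_univ, Fintype.card_fin, Nat.sub_sub_self hk] at ht'
  rw [← ht']
  exact IsHomogeneous.prod t fun i _ => isHomogeneous_charClass _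

theorem eval₂_fromPoint (P : (CohomologyRing G)[X]) :
    fromPoint ρ (P.eval₂ inflate (charClass PUnit.{1} (MonoidHom.snd G ℤˣ)))
      = P.eval₂ (fromBase ρ) (tautClass ρ) := by
  rw [hom_eval₂, fromPoint_charClass, tautClass_eq_charClass]
  congr 1
  ext a
  exact fromPoint_inflate ρ a

/-- The coefficients of `∏ᵢ (X + ψᵢ)` are Stiefel–Whitney classes of the sum of the characters
`ψᵢ`. -/
theorem isStiefelWhitney_coeff {d : ℕ} (b : Module.Basis (Fin d) ℝ V) (ψ : Fin d → G →* ℤˣ)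
    (hb : ∀ g i, ρ g (b i) = ((ψ i g : ℤ) : ℝ) • b i) :
    IsStiefelWhitney ρ fun k => if k ≤ d then (swPolynomial ψ).coeff (d - k) else 0 := by
  have hd : Module.finrank ℝ V = d := by simpa using Module.finrank_eq_card_basis b
  refine ⟨?_, fun k => ?_, fun k hk => if_neg (by omega), ?_⟩
  · simp [coeff_swPolynomial_self]
  · split_ifs with hk
    · exact isHomogeneous_coeff ψ hk
    · exact .zero k
  · rw [hd]
    have h : (swPolynomial ψ).eval₂ (fromBase ρ) (tautClass ρ) = 0 := by
      rw [← eval₂_fromPoint, eval₂_swPolynomial, map_prod]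
      simp only [fromPoint_charClass]
      exact prod_charClass_eq_zero b ψ hb
    rw [eval₂_eq_sum_range' _ (Nat.lt_succ_of_le (natDegree_swPolynomial_le ψ)),
      ← Finset.sum_range_reflect] at h
    rw [← h]
    refine Finset.sum_congr rfl fun k hk => ?_
    have hk' := Finset.mem_range_succ_iff.1 hk
    rw [if_pos hk', Nat.succ_sub_one]

/-- Stiefel–Whitney classes of a sum of characters of a finite group are unique. -/
theorem IsStiefelWhitney.eq [Finite G] {d : ℕ} (b : Module.Basis (Fin d) ℝ V)
    (ψ : Fin d → G →* ℤˣ) (hb : ∀ g i, ρ g (b i) = ((ψ i g : ℤ) : ℝ) • b i)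
    {w w' : ℕ → CohomologyRing G} (hw : IsStiefelWhitney ρ w) (hw' : IsStiefelWhitney ρ w') :
    w = w' := by
  have hd : Module.finrank ℝ V = d := by simpa using Module.finrank_eq_card_basis b
  funext k
  by_cases hk : d < k
  · rw [hw.eq_zero k (by omega), hw'.eq_zero k (by omega)]
  -- In dimension `0` only `w₀ = 1` remains; the kernel statement needs positive dimension.
  rcases d with _ | d
  · rw [show k = 0 by omega, hw.zero, hw'.zero]
  let P : (CohomologyRing G)[X] :=
    ∑ i ∈ Finset.range (d + 1 + 1), C (w i - w' i) * X ^ (d + 1 - i)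
  have hcoeff : ∀ k ≤ d + 1, P.coeff (d + 1 - k) = w k - w' k := by
    intro k hk
    simp only [P, finsetSum_coeff, coeff_C_mul, coeff_X_pow]
    rw [Finset.sum_eq_single_of_mem k (Finset.mem_range_succ_iff.2 hk)]
    · simp
    · intro i hi hik
      have := Finset.mem_range_succ_iff.1 hi
      rw [if_neg (by omega), mul_zero]
  have hP : P.eval₂ inflate (charClass PUnit.{1} (MonoidHom.snd G ℤˣ))
      = ∑ i ∈ Finset.range (d + 1 + 1), inflate (w i - w' i)
        * charClass PUnit.{1} (MonoidHom.snd G ℤˣ) ^ (d + 1 - i) := by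
    simp [P, eval₂_finsetSum]
  have hhom : IsHomogeneous (d + 1)
      (P.eval₂ inflate (charClass PUnit.{1} (MonoidHom.snd G ℤˣ))) := by
    rw [hP]
    refine IsHomogeneous.sum _ fun i hi => ?_
    have hi' := Finset.mem_range_succ_iff.1 hi
    have h1 : IsHomogeneous i (w i - w' i) := by
      rw [EquivariantCohomology.sub_eq_add]
      exact (hw.homogeneous i).add (hw'.homogeneous i)
    have h2 := (h1.pullback (MonoidHom.fst G ℤˣ) (fun _ : PUnit.{1} => PUnit.unit)
      continuous_const fun _ _ => rfl).mul
        ((isHomogeneous_charClass (X := PUnit.{1}) (MonoidHom.snd G ℤˣ)).pow (d + 1 - i))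
    rwa [mul_one, Nat.add_sub_cancel' hi'] at h2
  have hzero : fromPoint ρ (P.eval₂ inflate (charClass PUnit.{1} (MonoidHom.snd G ℤˣ))) = 0 := by
    have h1 := hw.relation
    have h2 := hw'.relation
    rw [hd] at h1 h2
    rw [eval₂_fromPoint]
    simp only [P, eval₂_finsetSum, eval₂_mul, eval₂_C, eval₂_X_pow]
    simp only [map_sub, sub_mul]
    rw [Finset.sum_sub_distrib, h1, h2, sub_zero]
  -- If the value is the Euler class, then `P = swPolynomial ψ`, with leading coefficient `1`; but
  -- that coefficient of `P` is `w 0 - w' 0 = 0`, so the ring is trivial.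
  rcases eq_zero_or_eq_prod_of_fromPoint_eq_zero b ψ hb _ hhom hzero with h | h
  · have h3 := eval₂_inflate_injective P h
    have h4 := hcoeff k (by omega)
    rw [h3, coeff_zero] at h4
    exact (sub_eq_zero.1 h4.symm)
  · rw [← eval₂_swPolynomial, ← sub_eq_zero, ← eval₂_sub] at h
    have h3 := sub_eq_zero.1 (eval₂_inflate_injective _ h)
    have h4 := hcoeff 0 (by omega)
    rw [h3, Nat.sub_zero, coeff_swPolynomial_self, hw.zero, hw'.zero, sub_self] at h4
    have : Subsingleton (CohomologyRing G) := subsingleton_of_zero_eq_one h4.symm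
    exact Subsingleton.elim _ _

theorem existsUnique_isStiefelWhitney [Finite G] {d : ℕ} (b : Module.Basis (Fin d) ℝ V)
    (ψ : Fin d → G →* ℤˣ) (hb : ∀ g i, ρ g (b i) = ((ψ i g : ℤ) : ℝ) • b i) :
    ∃! w, IsStiefelWhitney ρ w :=
  ⟨_, isStiefelWhitney_coeff b ψ hb, fun _ h => h.eq b ψ hb (isStiefelWhitney_coeff b ψ hb)⟩

theorem sw_eq_coeff [Finite G] {d : ℕ} (b : Module.Basis (Fin d) ℝ V)
    (ψ : Fin d → G →* ℤˣ) (hb : ∀ g i, ρ g (b i) = ((ψ i g : ℤ) : ℝ) • b i) :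
    sw ρ = fun k => if k ≤ d then (swPolynomial ψ).coeff (d - k) else 0 :=
  have h := isStiefelWhitney_coeff b ψ hb
  (Classical.epsilon_spec ⟨_, h⟩ : IsStiefelWhitney ρ (sw ρ)).eq b ψ hb h

/-- The total Stiefel–Whitney class of a sum of characters. -/
theorem totalSW_eq_prod [Finite G] {d : ℕ} (b : Module.Basis (Fin d) ℝ V)
    (ψ : Fin d → G →* ℤˣ) (hb : ∀ g i, ρ g (b i) = ((ψ i g : ℤ) : ℝ) • b i) :
    totalSW ρ = ∏ i, (1 + charClass PUnit.{1} (ψ i)) := by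
  have hd : Module.finrank ℝ V = d := by simpa using Module.finrank_eq_card_basis b
  -- The total class is the sum of all coefficients, that is, the value at `X = 1`.
  have h : (swPolynomial ψ).eval 1 = ∏ i, (1 + charClass PUnit.{1} (ψ i)) := by
    simp [swPolynomial, eval_prod]
  rw [← h, eval_eq_sum_range' (Nat.lt_succ_of_le (natDegree_swPolynomial_le ψ)),
    ← Finset.sum_range_reflect, totalSW, sw_eq_coeff b ψ hb, hd]
  refine Finset.sum_congr rfl fun k hk => ?_
  have hk' := Finset.mem_range_succ_iff.1 hk
  rw [Nat.succ_sub_one, one_pow, mul_one]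
  exact if_pos hk'

theorem sw_one_eq [Finite G] (ρ : Representation ℝ G ℝ) (ψ : G →* ℤˣ)
    (h : ∀ g, ρ g 1 = ((ψ g : ℤ) : ℝ)) : sw ρ 1 = charClass PUnit.{1} ψ := by
  rw [sw_eq_coeff (Module.Basis.singleton (Fin 1) ℝ) (fun _ => ψ) fun g i => by simp [h]]
  simp [swPolynomial]

end StiefelWhitney

/-! ### Characters of `C₂ⁿ` and diagonalization -/

namespace ElementaryAbelian

open StiefelWhitney EquivariantCohomology

/-- The character `g ↦ ∏ⱼ gⱼ ^ aⱼ` of `C₂ⁿ`. -/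
def sgnHom {n : ℕ} (a : Fin n → Fin 2) : C2 n →* ℤˣ where
  toFun g := ∏ j, g j ^ (a j : ℕ)
  map_one' := by simp
  map_mul' g h := by simp [mul_pow, Finset.prod_mul_distrib]

/-- The values of `sgnHom a`, as real numbers. -/
def sgnVal {n : ℕ} (a : Fin n → Fin 2) (g : C2 n) : ℝ := ((sgnHom a g : ℤ) : ℝ)

variable {n : ℕ}

theorem sgnVal_eq_prod (a : Fin n → Fin 2) (g : C2 n) :
    sgnVal a g = ∏ j, ((g j : ℤ) : ℝ) ^ (a j : ℕ) := by
  simp [sgnVal, sgnHom]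

theorem sgnVal_mul (a : Fin n → Fin 2) (g h : C2 n) :
    sgnVal a (g * h) = sgnVal a g * sgnVal a h := by simp [sgnVal]

theorem sgnVal_mul_self (a : Fin n → Fin 2) (g : C2 n) : sgnVal a g * sgnVal a g = 1 := by
  rcases Int.units_eq_one_or (sgnHom a g) with h | h <;> simp [sgnVal, h]

theorem sgnVal_comp (a : Fin n → Fin 2) (g : C2 n) (τ : Equiv.Perm (Fin n)) :
    sgnVal (a ∘ τ) (g ∘ τ) = sgnVal a g := by
  simp only [sgnVal_eq_prod]
  exact Equiv.prod_comp τ fun j => ((g j : ℤ) : ℝ) ^ (a j : ℕ)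

/-- The sum factors over the coordinates, which reduces orthogonality to `{±1}`. -/
theorem sum_sgnVal_mul (a b : Fin n → Fin 2) :
    ∑ g, sgnVal a g * sgnVal b g = if a = b then 2 ^ n else 0 := by
  simp only [sgnVal_eq_prod, ← Finset.prod_mul_distrib]
  rw [← Fintype.prod_sum fun (j : Fin n) (u : ℤˣ) => ((u : ℤ) : ℝ) ^ (a j : ℕ) * ((u : ℤ) : ℝ) ^ (b j : ℕ)]
  have h : ∀ x y : Fin 2, ∑ u : ℤˣ, ((u : ℤ) : ℝ) ^ (x : ℕ) * ((u : ℤ) : ℝ) ^ (y : ℕ)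
      = if x = y then 2 else 0 := by
    intro x y
    fin_cases x <;> fin_cases y <;> norm_num [UnitsInt.univ]
  simp only [h]
  split_ifs with hab
  · subst hab; simp
  · obtain ⟨j, hj⟩ := Function.ne_iff.1 hab
    exact Finset.prod_eq_zero (Finset.mem_univ j) (if_neg hj)

theorem sum_sgnVal (g : C2 n) : ∑ a, sgnVal a g = if g = 1 then 2 ^ n else 0 := by
  simp only [sgnVal_eq_prod]
  rw [← Fintype.prod_sum fun (j : Fin n) (x : Fin 2) => ((g j : ℤ) : ℝ) ^ (x : ℕ)]
  have h : ∀ u : ℤˣ, ∑ x : Fin 2, ((u : ℤ) : ℝ) ^ (x : ℕ) = if u = 1 then 2 else 0 := by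
    intro u
    rcases Int.units_eq_one_or u with rfl | rfl <;> norm_num
  simp only [h]
  split_ifs with hg
  · subst hg; simp
  · obtain ⟨j, hj⟩ := Function.ne_iff.1 hg
    exact Finset.prod_eq_zero (Finset.mem_univ j) (if_neg hj)

section Diagonal

/-- The basis `b` consists of eigenvectors of the characters `lam i`. -/
def IsDiagonal {V ι : Type*} [AddCommMonoid V] [Module ℝ V] (π : Representation ℝ (C2 n) V) (b : Module.Basis ι ℝ V)
    (lam : ι → Fin n → Fin 2) : Prop :=
  ∀ g i, π g (b i) = sgnVal (lam i) g • b i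

section Decomposition

variable {V : Type*} [AddCommGroup V] [Module ℝ V]

/-- The projection of a representation of `C₂ⁿ` to an isotypic component. -/
noncomputable def isotypicProj (π : Representation ℝ (C2 n) V) (a : Fin n → Fin 2) : V →ₗ[ℝ] V :=
  (2 ^ n : ℝ)⁻¹ • ∑ g, sgnVal a g • π g

/-- The isotypic component of `sgn_a`. -/
def isotypic (π : Representation ℝ (C2 n) V) (a : Fin n → Fin 2) : Submodule ℝ V where
  carrier := {v | ∀ g, π g v = sgnVal a g • v}
  add_mem' hv hw g := by rw [map_add, hv g, hw g, smul_add]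
  zero_mem' g := by simp
  smul_mem' c v hv g := by rw [map_smul, hv g, smul_comm]

theorem isotypicProj_mem (π : Representation ℝ (C2 n) V) (a : Fin n → Fin 2) (v : V) :
    isotypicProj π a v ∈ isotypic π a := by
  intro h
  simp only [isotypicProj, LinearMap.smul_apply, LinearMap.sum_apply, map_smul, map_sum]
  rw [smul_comm]
  congr 1
  rw [← Equiv.sum_comp (Equiv.mulLeft h) fun g => sgnVal a g • (π g) v, Finset.smul_sum]
  refine Finset.sum_congr rfl fun g _ => ?_
  rw [Equiv.coe_mulLeft, sgnVal_mul, smul_smul, ← mul_assoc, sgnVal_mul_self, one_mul, map_mul]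
  rfl

/-- By the dual orthogonality relation, only `g = 1` survives the sum over characters. -/
theorem sum_isotypicProj (π : Representation ℝ (C2 n) V) (v : V) :
    ∑ a, isotypicProj π a v = v := by
  simp only [isotypicProj, LinearMap.smul_apply, LinearMap.sum_apply]
  rw [← Finset.smul_sum, Finset.sum_comm]
  simp only [← Finset.sum_smul, sum_sgnVal, ite_smul, zero_smul]
  simp

theorem isotypicProj_of_mem (π : Representation ℝ (C2 n) V) (a b : Fin n → Fin 2) {v : V}
    (hv : v ∈ isotypic π b) : isotypicProj π a v = if a = b then v else 0 := by
  have hv' : ∀ g, π g v = sgnVal b g • v := hv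
  simp only [isotypicProj, LinearMap.smul_apply, LinearMap.sum_apply, hv', smul_smul]
  rw [← Finset.sum_smul, sum_sgnVal_mul]
  split_ifs <;> simp [smul_smul]

/-- The decomposition of a representation of `C₂ⁿ` into isotypic components. -/
noncomputable def isotypicEquiv (π : Representation ℝ (C2 n) V) : V ≃ₗ[ℝ] Π a, isotypic π a where
  toFun v a := ⟨isotypicProj π a v, isotypicProj_mem π a v⟩
  map_add' v w := by ext a; simp
  map_smul' c v := by ext a; simp
  invFun f := ∑ a, (f a : V)
  left_inv v := sum_isotypicProj π v
  right_inv f := by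
    ext a
    change isotypicProj π a (∑ b, (f b : V)) = f a
    rw [map_sum]
    simp only [isotypicProj_of_mem π a _ (f _).2]
    simp

/-- Every finite-dimensional real representation of `C₂ⁿ` is a sum of characters. -/
theorem exists_isDiagonal [FiniteDimensional ℝ V] (π : Representation ℝ (C2 n) V) :
    ∃ (b : Module.Basis (Fin (Module.finrank ℝ V)) ℝ V)
      (lam : Fin (Module.finrank ℝ V) → Fin n → Fin 2), IsDiagonal π b lam := by
  let B := (Pi.basis fun a => Module.finBasis ℝ (isotypic π a)).map (isotypicEquiv π).symm
  have hB : IsDiagonal π B fun p => p.1 := by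
    rintro g ⟨a, i⟩
    have h : B ⟨a, i⟩ ∈ isotypic π a := by
      change ∑ c, ((Pi.basis fun a => Module.finBasis ℝ (isotypic π a)) ⟨a, i⟩ c : V) ∈ _
      rw [Finset.sum_eq_single_of_mem a (Finset.mem_univ a)]
      · exact Subtype.coe_prop _
      · intro c _ hc
        simp [Pi.basis_apply, Pi.single_eq_of_ne hc]
    exact h g
  let e := Fintype.equivFinOfCardEq (Module.finrank_eq_card_basis B).symm
  exact ⟨B.reindex e, fun i => (e.symm i).1, fun g i => by
    rw [Module.Basis.reindex_apply]; exact hB g _⟩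

end Decomposition

section Character

variable {V ι : Type*} [AddCommGroup V] [Module ℝ V] {π : Representation ℝ (C2 n) V} {b : Module.Basis ι ℝ V} {lam : ι → Fin n → Fin 2}

theorem IsDiagonal.character [Fintype ι] (h : IsDiagonal π b lam) (g : C2 n) :
    π.character g = ∑ i, sgnVal (lam i) g := by
  classical
  rw [Representation.character, LinearMap.trace_eq_matrix_trace ℝ b, Matrix.trace]
  refine Finset.sum_congr rfl fun i _ => ?_
  simp [LinearMap.toMatrix_apply, h g i]

theorem IsDiagonal.sum_character_mul [Fintype ι] (h : IsDiagonal π b lam) (a : Fin n → Fin 2) :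
    ∑ g, π.character g * sgnVal a g = 2 ^ n * ∑ i, if lam i = a then 1 else 0 := by
  simp only [h.character, Finset.sum_mul]
  rw [Finset.sum_comm, Finset.mul_sum]
  exact Finset.sum_congr rfl fun i _ => by rw [sum_sgnVal_mul, mul_ite, mul_one, mul_zero]

end Character

section Isomorphism

variable {V ι : Type*} [AddCommMonoid V] [Module ℝ V] {π : Representation ℝ (C2 n) V}
  {b : Module.Basis ι ℝ V} {lam : ι → Fin n → Fin 2}

theorem IsDiagonal.map {W : Type*} [AddCommMonoid W] [Module ℝ W]
    {π' : Representation ℝ (C2 n) W} (h : IsDiagonal π b lam) (φ : Representation.Equiv π π') :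
    IsDiagonal π' (b.map φ.toLinearEquiv) lam := fun g i => by
  have h1 := LinearMap.congr_fun (φ.isIntertwining' g) (b i)
  have h2 : φ.toLinearEquiv (π g (b i)) = π' g (φ.toLinearEquiv (b i)) := h1
  rw [Module.Basis.map_apply, ← h2, h g i, map_smul]

/-- Sums of characters with the same multiplicities are isomorphic. -/
theorem IsDiagonal.nonempty_equiv {W κ : Type*} [AddCommMonoid W] [Module ℝ W]
    {π' : Representation ℝ (C2 n) W} {b' : Module.Basis κ ℝ W} {lam' : κ → Fin n → Fin 2}
    (h : IsDiagonal π b lam) (h' : IsDiagonal π' b' lam') (e : ι ≃ κ)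
    (he : ∀ i, lam' (e i) = lam i) : Nonempty (Representation.Equiv π π') :=
  ⟨.mk (b.equiv b' e) fun g => b.ext fun i => by
    simp [h g i, h' g (e i), he]⟩

theorem isDiagonal_directSum {η : Type*} [DecidableEq η] {W : η → Type*} {κ : η → Type*}
    [∀ i, AddCommMonoid (W i)] [∀ i, Module ℝ (W i)] {ρ : ∀ i, Representation ℝ (C2 n) (W i)}
    {b : ∀ i, Module.Basis (κ i) ℝ (W i)} {lam : ∀ i, κ i → Fin n → Fin 2}
    (h : ∀ i, IsDiagonal (ρ i) (b i) (lam i)) :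
    ∃ B : Module.Basis (Σ i, κ i) ℝ (⨁ i, W i),
      IsDiagonal (Representation.directSum ρ) B fun p => lam p.1 p.2 := by
  refine ⟨DFinsupp.basis b, ?_⟩
  rintro g ⟨i, k⟩
  have hB : DFinsupp.basis b ⟨i, k⟩ = DirectSum.lof ℝ η W i (b i k) := by
    change (DFinsupp.mapRange.linearEquiv fun i => (b i).repr).symm
      (sigmaFinsuppLequivDFinsupp ℝ (Finsupp.single ⟨i, k⟩ 1)) = DFinsupp.single i (b i k)
    rw [LinearEquiv.symm_apply_eq]
    refine (sigmaFinsuppEquivDFinsupp_single _ _).trans ?_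
    simp
  rw [hB]
  change DirectSum.lmap _ _ = _
  rw [DirectSum.lmap_lof, h i g k, map_smul]

end Isomorphism

end Diagonal

end ElementaryAbelian

namespace ElementaryAbelian

open StiefelWhitney EquivariantCohomology

/-! ### Binary strings and multiplicities -/

variable {n : ℕ}

theorem exists_equiv_of_card_eq {α β γ : Type*} [Fintype α] [Fintype β] [DecidableEq γ]
    (f : α → γ) (g : β → γ)
    (h : ∀ c, ∑ i, (if f i = c then 1 else 0) = ∑ i, if g i = c then 1 else 0) :
    ∃ e : α ≃ β, ∀ i, g (e i) = f i := by
  have h' : ∀ c, Nonempty ({i // f i = c} ≃ {i // g i = c}) := fun c => by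
    refine ⟨Fintype.equivOfCardEq ?_⟩
    have := h c
    rw [← Finset.card_filter, ← Finset.card_filter] at this
    rwa [Fintype.card_subtype, Fintype.card_subtype]
  exact ⟨Equiv.ofFiberEquiv fun c => (h' c).some, Equiv.ofFiberEquiv_map _⟩

/-- The number of ones of a binary string. -/
def weight (a : Fin n → Fin 2) : Fin (n + 1) :=
  ⟨∑ j, (a j : ℕ), Nat.lt_succ_of_le (by
    simpa using Finset.sum_le_card_nsmul Finset.univ (fun j => (a j : ℕ)) 1
      fun j _ => Nat.le_of_lt_succ (a j).2)⟩

theorem mem_strings {i : ℕ} {a : Fin n → Fin 2} : a ∈ strings n i ↔ (weight a : ℕ) = i := by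
  simp [strings, weight]

theorem exists_perm_of_weight_eq {a b : Fin n → Fin 2} (h : weight a = weight b) :
    ∃ τ : Equiv.Perm (Fin n), b ∘ τ = a := by
  have h1 : ∀ a : Fin n → Fin 2, ∑ i, (if a i = 1 then 1 else 0) = (weight a : ℕ) := by
    intro a
    refine Finset.sum_congr rfl fun i _ => ?_
    generalize a i = x
    revert x; decide
  have h2 : ∀ a : Fin n → Fin 2,
      ∑ i, (if a i = 0 then 1 else 0) + ∑ i, (if a i = 1 then 1 else 0) = n := by
    intro a
    rw [← Finset.sum_add_distrib, Finset.sum_congr rfl (g := fun _ => 1)]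
    · simp
    · intro i _
      generalize a i = x
      revert x; decide
  obtain ⟨e, he⟩ := exists_equiv_of_card_eq a b fun c => by
    have ha := h2 a
    have hb := h2 b
    have ha1 := h1 a
    have hb1 := h1 b
    rw [h] at ha1
    fin_cases c
    · change ∑ i, (if a i = 0 then 1 else 0) = ∑ i, if b i = 0 then 1 else 0
      omega
    · change ∑ i, (if a i = 1 then 1 else 0) = ∑ i, if b i = 1 then 1 else 0
      omega
  exact ⟨e, funext he⟩

/-- The string `1⋯10⋯0` with `k` ones. -/
def initialString (n k : ℕ) : Fin n → Fin 2 := fun j => if (j : ℕ) < k then 1 else 0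

theorem weight_initialString (i : Fin (n + 1)) : weight (initialString n i) = i := by
  refine Fin.ext ?_
  have h : ∀ j : Fin n, ((initialString n i j : Fin 2) : ℕ) = if (j : ℕ) < i then 1 else 0 := by
    intro j
    rw [initialString]
    split_ifs <;> rfl
  simp only [weight, h]
  rw [Fin.sum_univ_eq_sum_range (fun j => if j < (i : ℕ) then 1 else 0), ← Finset.card_filter]
  have : (Finset.range n).filter (· < (i : ℕ)) = Finset.range i := by
    ext j
    simp only [Finset.mem_filter, Finset.mem_range]
    omega
  rw [this, Finset.card_range]

/-- The element of `C₂ⁿ` with entries `(-1) ^ aⱼ`. -/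
def ofString (n : ℕ) : (Fin n → Fin 2) ≃ C2 n where
  toFun a j := if a j = 1 then -1 else 1
  invFun g j := if g j = -1 then 1 else 0
  left_inv a := funext fun j => by
    change (if (if a j = 1 then -1 else 1 : ℤˣ) = -1 then (1 : Fin 2) else 0) = a j
    generalize a j = x
    revert x; decide
  right_inv g := funext fun j => by
    change (if (if g j = -1 then 1 else 0 : Fin 2) = 1 then (-1 : ℤˣ) else 1) = g j
    generalize g j = x
    revert x; decide

theorem ofString_initialString (k : ℕ) : ofString n (initialString n k) = hElt n k := by
  funext j
  change (if (if (j : ℕ) < k then 1 else 0 : Fin 2) = 1 then (-1 : ℤˣ) else 1)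
    = if (j : ℕ) < k then -1 else 1
  split_ifs <;> simp_all

/-- Both sides are `(-1)^{a·b}`. This symmetry turns a sum over group elements into characters of
the `σ_k`. -/
theorem sgnVal_ofString_comm (a b : Fin n → Fin 2) :
    sgnVal a (ofString n b) = sgnVal b (ofString n a) := by
  simp only [sgnVal, sgnHom, MonoidHom.coe_mk, OneHom.coe_mk]
  congr 3
  funext j
  change (if b j = 1 then (-1 : ℤˣ) else 1) ^ (a j : ℕ) = (if a j = 1 then -1 else 1) ^ (b j : ℕ)
  generalize a j = x
  generalize b j = y
  revert x y; decide

theorem isDiagonal_sgn (a : Fin n → Fin 2) :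
    IsDiagonal (sgn a) (Module.Basis.singleton Unit ℝ) fun _ => a := fun g i => by
  rw [sgnVal_eq_prod]
  rfl

theorem exists_isDiagonal_sigma (n k : ℕ) :
    ∃ B : Module.Basis (Σ _ : strings n k, Unit) ℝ (⨁ _ : strings n k, ℝ),
      IsDiagonal (sigma n k) B fun p => p.1.1 := by
  unfold sigma
  exact isDiagonal_directSum (ρ := fun a : strings n k => sgn a.1)
    (b := fun _ => Module.Basis.singleton Unit ℝ) (lam := fun a _ => a.1)
    fun a => isDiagonal_sgn a.1

/-- The index set of the standard basis of `⨁ᵢ cᵢ σᵢ`. -/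
abbrev SumIndex (n : ℕ) (c : Fin (n + 1) → ℕ) : Type :=
  Σ p : (Σ i : Fin (n + 1), Fin (c i)), Σ _ : strings n (p.1 : ℕ), Unit

theorem exists_isDiagonal_sumSigma (n : ℕ) (c : Fin (n + 1) → ℕ) :
    ∃ B : Module.Basis (SumIndex n c) ℝ
        (⨁ p : (Σ i : Fin (n + 1), Fin (c i)), (⨁ _ : strings n (p.1 : ℕ), ℝ)),
      IsDiagonal (sumSigma n c) B fun p => p.2.1.1 := by
  choose B hB using exists_isDiagonal_sigma n
  unfold sumSigma
  exact isDiagonal_directSum (ρ := fun p : (Σ i : Fin (n + 1), Fin (c i)) => sigma n (p.1 : ℕ))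
    (b := fun p => B p.1) (lam := fun _ a => a.1.1) fun p => hB p.1

/-- Stated for any commutative monoid to serve twice: in `Multiplicative ℕ` it counts
multiplicities, in cohomology it groups the factors of the total class. -/
theorem prod_sumSigma {M : Type*} [CommMonoid M] (c : Fin (n + 1) → ℕ) (F : (Fin n → Fin 2) → M) :
    ∏ p : SumIndex n c, F p.2.1.1
      = ∏ i : Fin (n + 1), (∏ a ∈ strings n i, F a) ^ c i := by
  rw [Fintype.prod_sigma, Fintype.prod_sigma]
  refine Finset.prod_congr rfl fun i _ => ?_
  simp only [Fintype.prod_sigma, Fintype.prod_unique]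
  change ∏ _x : Fin (c i), ∏ a : strings n (i : ℕ), F a = _
  rw [Finset.prod_const, Finset.card_univ, Fintype.card_fin, Finset.prod_coe_sort (strings n i) F]

theorem card_sumSigma (c : Fin (n + 1) → ℕ) (a : Fin n → Fin 2) :
    ∑ p : SumIndex n c,
      (if p.2.1.1 = a then 1 else 0) = c (weight a) := by
  have h := prod_sumSigma (M := Multiplicative ℕ) c fun b => .ofAdd (if b = a then 1 else 0)
  rw [← ofAdd_sum] at h
  refine (congrArg Multiplicative.toAdd h).trans ?_
  rw [toAdd_prod, Finset.sum_eq_single_of_mem (weight a) (Finset.mem_univ _)]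
  · simp [mem_strings]
  · intro i _ hi
    rw [toAdd_pow, toAdd_prod]
    have : a ∉ strings n i := fun h => hi (Fin.ext (mem_strings.1 h).symm)
    simp [this]

/-! ### Representations invariant under `S_n` -/

section Invariant

variable {V : Type*} [AddCommGroup V] [Module ℝ V] {π : Representation ℝ (C2 n) V}

theorem IsSymInvariant.character_comp (hπ : IsSymInvariant π) (τ : Equiv.Perm (Fin n))
    (g : C2 n) : π.character (g ∘ τ) = π.character g := by
  obtain ⟨φ⟩ := hπ τ
  exact congrFun (Representation.char_iso φ) g

theorem IsSymInvariant.character_ofString (hπ : IsSymInvariant π) (a : Fin n → Fin 2) :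
    π.character (ofString n a) = π.character (hElt n (weight a)) := by
  obtain ⟨τ, hτ⟩ := exists_perm_of_weight_eq (weight_initialString (weight a)).symm
  have h : ofString n a = ofString n (initialString n (weight a)) ∘ τ := by
    conv_lhs => rw [← hτ]
    rfl
  rw [h, hπ.character_comp, ofString_initialString]

theorem IsSymInvariant.sum_character_mul_comp (hπ : IsSymInvariant π) (τ : Equiv.Perm (Fin n))
    (a : Fin n → Fin 2) :
    ∑ g, π.character g * sgnVal (a ∘ τ) g = ∑ g, π.character g * sgnVal a g := by
  rw [← Equiv.sum_comp (Equiv.arrowCongr τ.symm (Equiv.refl ℤˣ))]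
  refine Finset.sum_congr rfl fun g _ => ?_
  change π.character (g ∘ τ) * sgnVal (a ∘ τ) (g ∘ τ) = _
  rw [hπ.character_comp, sgnVal_comp]

theorem IsSymInvariant.exists_equiv [FiniteDimensional ℝ V] (hπ : IsSymInvariant π) :
    ∃ c : Fin (n + 1) → ℕ, Nonempty (Representation.Equiv π (sumSigma n c)) := by
  obtain ⟨b, lam, hb⟩ := exists_isDiagonal π
  -- The multiplicity of one chosen string of each weight; invariance gives every other string of
  -- that weight the same multiplicity.
  let c : Fin (n + 1) → ℕ := fun i => ∑ j, if lam j = initialString n i then 1 else 0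
  obtain ⟨B, hB⟩ := exists_isDiagonal_sumSigma n c
  obtain ⟨e, he⟩ := exists_equiv_of_card_eq lam
    (fun p : SumIndex n c => p.2.1.1)
    fun a => by
      rw [card_sumSigma]
      obtain ⟨τ, hτ⟩ := exists_perm_of_weight_eq (weight_initialString (weight a))
      have h := hπ.sum_character_mul_comp τ a
      rw [hτ, hb.sum_character_mul, hb.sum_character_mul] at h
      have h' := mul_left_cancel₀ (by positivity) h
      exact_mod_cast h'.symm
  exact ⟨c, hb.nonempty_equiv hB e he⟩

theorem IsSymInvariant.multiplicity_eq (hπ : IsSymInvariant π) (c : Fin (n + 1) → ℕ)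
    (φ : Representation.Equiv π (sumSigma n c)) (i : Fin (n + 1)) :
    (c i : ℝ) = 1 / 2 ^ n * ∑ k ∈ Finset.range (n + 1),
      (sigma n k).character (hElt n i) * π.character (hElt n k) := by
  obtain ⟨B, hB⟩ := exists_isDiagonal_sumSigma n c
  have h := (hB.map φ.symm).sum_character_mul (initialString n i)
  have hc : ((∑ p : SumIndex n c,
      (if p.2.1.1 = initialString n i then 1 else 0) : ℕ) : ℝ) = c i := by
    rw [card_sumSigma, weight_initialString]
  push_cast at hc
  rw [hc] at h
  have hσ : ∀ k : ℕ, (sigma n k).character (hElt n i)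
      = ∑ a ∈ strings n k, sgnVal a (hElt n i) := by
    intro k
    obtain ⟨B', hB'⟩ := exists_isDiagonal_sigma n k
    rw [hB'.character]
    simp only [Fintype.sum_sigma, Finset.univ_unique, Finset.sum_singleton]
    exact Finset.sum_coe_sort (strings n k) fun a => sgnVal a (hElt n i)
  have hsum : ∑ g, π.character g * sgnVal (initialString n i) g
      = ∑ k ∈ Finset.range (n + 1),
        (sigma n k).character (hElt n i) * π.character (hElt n k) := by
    -- Group elements are indexed by strings and grouped by weight `k`; on each group the character
    -- of `π` is constant, equal to its value at `h_k`.
    rw [← Equiv.sum_comp (ofString n),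
      ← Finset.sum_fiberwise_of_maps_to (t := Finset.range (n + 1))
        (g := fun a : Fin n → Fin 2 => (weight a : ℕ)) fun a _ => Finset.mem_range.2 (weight a).2]
    refine Finset.sum_congr rfl fun k _ => ?_
    rw [hσ, Finset.sum_mul]
    refine Finset.sum_congr (by ext a; simp [mem_strings]) fun a ha => ?_
    rw [hπ.character_ofString, sgnVal_ofString_comm, ofString_initialString, mul_comm,
      mem_strings.1 ha]
  rw [← hsum, h]
  field_simp

end Invariant

/-! ### The total class in terms of the `v_j` -/

section Classes

theorem charClass_prod_pow {s : Finset (Fin n)} (l : Fin n → Fin 2) (χ : Fin n → C2 n →* ℤˣ) :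
    charClass PUnit.{1} (∏ j ∈ s, χ j ^ (l j : ℕ))
      = ∑ j ∈ s, (l j : ℕ) • charClass PUnit.{1} (χ j) := by
  classical
  have hpow : ∀ (χ : C2 n →* ℤˣ) (m : ℕ),
      charClass PUnit.{1} (χ ^ m) = m • charClass PUnit.{1} χ := by
    intro χ m
    induction m with
    | zero => rw [pow_zero, charClass_one, zero_smul]
    | succ m ih => rw [pow_succ, charClass_mul, ih, succ_nsmul]
  induction s using Finset.induction_on with
  | empty => simp [charClass_one]
  | insert j s hj ih => rw [Finset.prod_insert hj, Finset.sum_insert hj, charClass_mul, ih, hpow]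

theorem vClass_eq (j : Fin n) : vClass j = charClass PUnit.{1} (sgnHom (Pi.single j 1)) :=
  sw_one_eq _ _ fun g => by
    have h : sgnVal (Pi.single j 1) g = ∏ i, ((g i : ℤ) : ℝ) ^ ((Pi.single j 1 : Fin n → Fin 2) i : ℕ) :=
      sgnVal_eq_prod _ _
    rw [sgnVal] at h
    rw [h]
    exact mul_one _

/-- The class of a character is additive, and `sgn_l` is the product of the coordinate characters
with `l j = 1`. -/
theorem dotV_eq (l : Fin n → Fin 2) : dotV l = charClass PUnit.{1} (sgnHom l) := by
  have h : sgnHom l = ∏ j, sgnHom (Pi.single j 1) ^ (l j : ℕ) := by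
    refine MonoidHom.ext fun g => ?_
    rw [MonoidHom.finsetProd_apply]
    simp only [MonoidHom.pow_apply, sgnHom, MonoidHom.coe_mk, OneHom.coe_mk]
    refine Finset.prod_congr rfl fun j _ => ?_
    rw [Finset.prod_eq_single_of_mem j (Finset.mem_univ j)]
    · simp
    · intro i _ hij
      simp [hij]
  rw [h, charClass_prod_pow]
  simp only [dotV, vClass_eq]

variable {V ι : Type*} [AddCommGroup V] [Module ℝ V] {π : Representation ℝ (C2 n) V}

theorem IsDiagonal.totalSW_eq [Fintype ι] {b : Module.Basis ι ℝ V} {lam : ι → Fin n → Fin 2}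
    (h : IsDiagonal π b lam) : totalSW π = ∏ i, (1 + dotV (lam i)) := by
  let e := Fintype.equivFin ι
  rw [totalSW_eq_prod (b.reindex e) (fun i => sgnHom (lam (e.symm i))) fun g i => by
    rw [Module.Basis.reindex_apply]; exact h g _]
  simp only [← dotV_eq]
  exact Equiv.prod_comp e.symm fun i => 1 + dotV (lam i)

end Classes

end ElementaryAbelian

open StiefelWhitney ElementaryAbelian in
theorem mainTheorem10 (n : ℕ) {V : Type*} [AddCommGroup V] [Module ℝ V] [FiniteDimensional ℝ V]
    (π : Representation ℝ (C2 n) V) (hπ : IsSymInvariant π) :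
    (∃! w : ℕ → CohomologyRing (C2 n), IsStiefelWhitney π w) ∧
    (∃ c : Fin (n + 1) → ℕ, Nonempty (Representation.Equiv π (sumSigma n c))) ∧
    ∀ c : Fin (n + 1) → ℕ, Nonempty (Representation.Equiv π (sumSigma n c)) →
      (∀ i : Fin (n + 1), (c i : ℝ) =
        1 / 2 ^ n * ∑ k ∈ Finset.range (n + 1),
          (sigma n k).character (hElt n i) * π.character (hElt n k)) ∧
      totalSW π = ∏ i : Fin n, (∏ l ∈ strings n (i + 1), (1 + dotV l)) ^ c i.succ := by
  refine ⟨?_, hπ.exists_equiv, ?_⟩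
  · obtain ⟨b, lam, hb⟩ := exists_isDiagonal π
    exact existsUnique_isStiefelWhitney b (fun i => sgnHom (lam i)) hb
  · rintro c ⟨φ⟩
    refine ⟨hπ.multiplicity_eq c φ, ?_⟩
    obtain ⟨B, hB⟩ := exists_isDiagonal_sumSigma n c
    -- The only string of weight `0` is the zero string, whose factor is `1`; hence the product
    -- starts at `i = 1`.
    have h0 : ∏ l ∈ strings n ((0 : Fin (n + 1)) : ℕ), (1 + dotV l) = 1 := by
      refine Finset.prod_eq_one fun l hl => ?_
      have hl0 : ∑ j, (l j : ℕ) = 0 := mem_strings.1 hl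
      rw [dotV, Finset.sum_eq_zero, add_zero]
      intro j hj
      rw [Finset.sum_eq_zero_iff.1 hl0 j hj, zero_smul]
    rw [(hB.map φ.symm).totalSW_eq, prod_sumSigma c fun l => 1 + dotV l, Fin.prod_univ_succ, h0,
      one_pow, one_mul]
    rfl
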